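/- Let $n\ge 1$, $1\le p<\infty$ and $1<q\le\infty$. A cube is a compact cube in $\mathbb R^n$ with edges parallel to the coordinate axes; $|Q|$, $c(Q)$ and $\ell(Q)$ denote the volume, the centre and the side length ($\ell(Q)>0$) of a cube $Q$. For $\phi:\mathbb R^n\times(0,\infty)\to(0,\infty)$ and a measurable function $g$ on $\mathbb R^n$ put $$\|g\|_{\mathcal M_{p,\phi}}=\sup_{Q}\frac1{\phi(c(Q),\ell(Q))}\Bigl(\frac1{|Q|}\int_Q|g(y)|^p\,dy\Bigr)^{1/p},\qquad \|g\|_{W\mathcal M_{p,\phi}}=\sup_{T>0}T\,\|\chi_{\{|g|>T\}}\|_{\mathcal M_{p,\phi}},$$ where $Q$ runs over all cubes. For a sequence $F=\{f_j\}_{j=-\infty}^\infty$ of measurable functions put $$\|F\|_{\mathcal M_{p,\phi}(l_q)}=\bigl\|\,\|\{f_j(\cdot)\}_j\|_{l_q}\bigr\|_{\mathcal M_{p,\phi}},\qquad \|F\|_{W\mathcal M_{p,\phi}(l_q)}=\bigl\|\,\|\{f_j(\cdot)\}_j\|_{l_q}\bigr\|_{W\mathcal M_{p,\phi}},$$ and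 let $\mathcal M_{p,\phi}(l_q)$ and $W\mathcal M_{p,\phi}(l_q)$ be the sets of those $F$ for which the respective quantity is finite. Let $Mf(x)=\sup_{Q\ni x}\frac1{|Q|}\int_Q|f(y)|\,dy$, the supremum being over all cubes $Q$ containing $x$, and $MF=\{Mf_j\}_{j=-\infty}^\infty$. **Theorem.** Let $\phi_1,\phi_2:\mathbb R^n\times(0,\infty)\to(0,\infty)$ be functions for which there is a constant $K$ such that, for all $x\in\mathbb R^n$ and $t>0$, $$\int_t^\infty\Bigl(\inf_{\tau<s<\infty}\phi_1(x,s)\,s^{n/p}\Bigr)\frac{d\tau}{\tau^{n/p+1}}\le K\,\phi_2(x,t).$$ 1. If $1<p<\infty$, then $M$ is bounded from $\mathcal M_{p,\phi_1}(l_q)$ to $\mathcal M_{p,\phi_2}(l_q)$: there is a constant $C$ such that every sequence $F\in\mathcal M_{p,\phi_1}(l_q)$ of complex-valued measurable functions satisfies $MF\in\mathcal M_{p,\phi_2}(l_q)$ and $\|MF\|_{\mathcal M_{p,\phi_2}(l_q)}\le C\,\|F\|_{\mathcal M_{p,\phi_1}(l_q)}$. 2. If $1\le p<\infty$, then $M$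 is bounded from $\mathcal M_{p,\phi_1}(l_q)$ to the weak space $W\mathcal M_{p,\phi_2}(l_q)$: there is a constant $C$ such that every sequence $F\in\mathcal M_{p,\phi_1}(l_q)$ of complex-valued measurable functions satisfies $MF\in W\mathcal M_{p,\phi_2}(l_q)$ and $\|MF\|_{W\mathcal M_{p,\phi_2}(l_q)}\le C\,\|F\|_{\mathcal M_{p,\phi_1}(l_q)}$. In particular, for $p=1$, $M$ is bounded from $\mathcal M_{1,\phi_1}(l_q)$ to $W\mathcal M_{1,\phi_2}(l_q)$. -/

import Mathlib

open MeasureTheory Set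
open scoped ENNReal NNReal

noncomputable section

namespace GenMorrey

/-- The compact cube in `ℝⁿ` with centre `c` and side length `l`, with edges parallel to the
coordinate axes (`Fin n → ℝ` carries the supremum distance). -/
def cube {n : ℕ} (c : Fin n → ℝ) (l : ℝ) : Set (Fin n → ℝ) :=
  Metric.closedBall c (l / 2)

/-- The (uncentred) Hardy–Littlewood maximal function: the supremum of the averages of `|f|` over
all nondegenerate cubes containing `x`. -/
def maximalFunction {n : ℕ} (f : (Fin n → ℝ) → ℂ) (x : Fin n → ℝ) : ℝ≥0∞ :=
  ⨆ (c : Fin n → ℝ) (l : ℝ) (_ : 0 < l) (_ : x ∈ cube c l),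
    (volume (cube c l))⁻¹ * ∫⁻ y in cube c l, ‖f y‖ₑ

/-- The `l_q` norm of a two-sided sequence, for `0 < q ≤ ∞`. The entries may be complex numbers or
elements of `[0, ∞]`. -/
def lqNorm {ε : Type*} [ENorm ε] (q : ℝ≥0∞) (a : ℤ → ε) : ℝ≥0∞ :=
  if q = ∞ then ⨆ j, ‖a j‖ₑ else (∑' j, ‖a j‖ₑ ^ q.toReal) ^ (1 / q.toReal)

/-- The generalized Morrey norm of a function whose modulus is `g`. -/
def morreyNorm {n : ℕ} (p : ℝ) (φ : (Fin n → ℝ) → ℝ → ℝ) (g : (Fin n → ℝ) → ℝ≥0∞) : ℝ≥0∞ :=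
  ⨆ (c : Fin n → ℝ) (l : ℝ) (_ : 0 < l),
    (ENNReal.ofReal (φ c l))⁻¹ *
      ((volume (cube c l))⁻¹ * ∫⁻ y in cube c l, g y ^ p) ^ (1 / p)

/-- The weak generalized Morrey norm of a function whose modulus is `g`. -/
def weakMorreyNorm {n : ℕ} (p : ℝ) (φ : (Fin n → ℝ) → ℝ → ℝ) (g : (Fin n → ℝ) → ℝ≥0∞) : ℝ≥0∞ :=
  ⨆ (T : ℝ≥0) (_ : 0 < T), (T : ℝ≥0∞) * morreyNorm p φ ({x | (T : ℝ≥0∞) < g x}.indicator 1)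

/-- The norm of `M_{p,φ}(l_q)`. -/
def morreyLqNorm {n : ℕ} {ε : Type*} [ENorm ε] (p : ℝ) (φ : (Fin n → ℝ) → ℝ → ℝ) (q : ℝ≥0∞)
    (F : ℤ → (Fin n → ℝ) → ε) : ℝ≥0∞ :=
  morreyNorm p φ fun x => lqNorm q fun j => F j x

/-- The norm of `WM_{p,φ}(l_q)`. -/
def weakMorreyLqNorm {n : ℕ} {ε : Type*} [ENorm ε] (p : ℝ) (φ : (Fin n → ℝ) → ℝ → ℝ) (q : ℝ≥0∞)
    (F : ℤ → (Fin n → ℝ) → ε) : ℝ≥0∞ :=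
  weakMorreyNorm p φ fun x => lqNorm q fun j => F j x

/-- Membership in `M_{p,φ}(l_q)`: a sequence of Lebesgue measurable functions of finite norm. -/
def MemMorreyLq {n : ℕ} {ε : Type*} [ENorm ε] [MeasurableSpace ε] (p : ℝ)
    (φ : (Fin n → ℝ) → ℝ → ℝ) (q : ℝ≥0∞) (F : ℤ → (Fin n → ℝ) → ε) : Prop :=
  (∀ j, AEMeasurable (F j) volume) ∧ morreyLqNorm p φ q F < ∞

/-- Membership in `WM_{p,φ}(l_q)`. -/
def MemWeakMorreyLq {n : ℕ} {ε : Type*} [ENorm ε] [MeasurableSpace ε] (p : ℝ)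
    (φ : (Fin n → ℝ) → ℝ → ℝ) (q : ℝ≥0∞) (F : ℤ → (Fin n → ℝ) → ε) : Prop :=
  (∀ j, AEMeasurable (F j) volume) ∧ weakMorreyLqNorm p φ q F < ∞

/-- The condition
`∫_t^∞ (inf_{τ < s < ∞} φ₁(x,s) s^{n/p}) τ^{-n/p-1} dτ ≤ K φ₂(x,t)` for all `x` and all `t > 0`,
with `K` independent of `x` and `t`. -/
def IntegralCondition {n : ℕ} (p : ℝ) (φ₁ φ₂ : (Fin n → ℝ) → ℝ → ℝ) : Prop :=
  ∃ K : ℝ≥0, ∀ (x : Fin n → ℝ) (t : ℝ), 0 < t →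
    ∫⁻ τ in Ioi t, (⨅ (s : ℝ) (_ : τ < s), ENNReal.ofReal (φ₁ x s * s ^ ((n : ℝ) / p))) *
        ENNReal.ofReal (τ ^ (-((n : ℝ) / p) - 1))
      ≤ K * ENNReal.ofReal (φ₂ x t)

end GenMorrey

end

noncomputable section

namespace GenMorrey

open Filter Topology

variable {n : ℕ}

/-! Fix a cube Q with centre c and side l, and let g be the pointwise l_q norm of the sequence. Both
claims reduce to bounding MF on Q by the Hardy-type quantity J = ∫_l^∞ ‖g‖_{L^p(cube c t)}
t^{-n/p-1} dt (`tailIntegral`). The integral condition then finishes: ‖g‖_{L^p(cube c t)} increases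
with t, so it is at most the Morrey norm of g times the infimum of φ₁(c,s) s^{n/p} over s > t,
whence J is at most K φ₂(c,l) times that norm (`tailIntegral_le_morreyNorm`).

To bound MF by J, split every f_j at the doubled cube. The outer part is at most a multiple of J at
each point of Q, by Minkowski and Hölder (`lqNorm_maximal_outer_le`). The inner part is handled by
the Fefferman–Stein inequalities on ℝⁿ (`fefferman_stein_strong`, `fefferman_stein_weak`), and
|Q|^{-1/p} ‖g‖_{L^p(2Q)} is again at most a multiple of J.

The Fefferman–Stein inequalities are proved from a Vitali covering. It gives the weak type (1,1)
bound with weights w and Mw; interpolation gives ∫ (Mf)^r w ≤ C ∫ f^r Mw for r > 1. Summing over j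
settles p = q = r. For p > r, duality applies with a power of the truncated vector maximal function
as weight. For p < r, one interpolates the case p = r with a vector weak type (1,1) bound, whose bad
part is treated by a continuous Whitney averaging in place of Calderón–Zygmund cubes. For q = ∞ the
supremum of the Mf_j is at most M of the supremum. -/

/-- The Hardy–Littlewood maximal function of a `[0, ∞]`-valued function. -/
def maximal (f : (Fin n → ℝ) → ℝ≥0∞) (x : Fin n → ℝ) : ℝ≥0∞ :=
  ⨆ (c : Fin n → ℝ) (l : ℝ) (_ : 0 < l) (_ : x ∈ cube c l),
    (volume (cube c l))⁻¹ * ∫⁻ y in cube c l, f y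

theorem maximalFunction_eq_maximal (f : (Fin n → ℝ) → ℂ) :
    maximalFunction f = maximal fun y => ‖f y‖ₑ := rfl

/-! ### Cubes and elementary properties of the maximal operator. -/

theorem volume_cube (c : Fin n → ℝ) {l : ℝ} (hl : 0 ≤ l) :
    volume (cube c l) = ENNReal.ofReal (l ^ n) := by
  rw [cube, Real.volume_pi_closedBall _ (by positivity), Fintype.card_fin]
  congr 2; ring

theorem volume_cube_ne_zero (c : Fin n → ℝ) {l : ℝ} (hl : 0 < l) : volume (cube c l) ≠ 0 := by
  rw [volume_cube c hl.le]
  simpa using pow_pos hl n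

theorem volume_cube_ne_top (c : Fin n → ℝ) {l : ℝ} (hl : 0 < l) : volume (cube c l) ≠ ∞ := by
  rw [volume_cube c hl.le]
  exact ENNReal.ofReal_ne_top

theorem measurableSet_cube (c : Fin n → ℝ) (l : ℝ) : MeasurableSet (cube c l) :=
  Metric.isClosed_closedBall.measurableSet

theorem cube_subset_cube (c : Fin n → ℝ) {l m : ℝ} (h : l ≤ m) : cube c l ⊆ cube c m :=
  Metric.closedBall_subset_closedBall (by linarith)

theorem average_le_maximal (f : (Fin n → ℝ) → ℝ≥0∞) {c x : Fin n → ℝ} {l : ℝ} (hl : 0 < l)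
    (hx : x ∈ cube c l) :
    (volume (cube c l))⁻¹ * ∫⁻ y in cube c l, f y ≤ maximal f x :=
  le_iSup₂_of_le c l (le_iSup₂_of_le hl hx le_rfl)

theorem lintegral_cube_le_maximal (f : (Fin n → ℝ) → ℝ≥0∞) {c x : Fin n → ℝ} {l : ℝ} (hl : 0 < l)
    (hx : x ∈ cube c l) :
    ∫⁻ y in cube c l, f y ≤ volume (cube c l) * maximal f x := by
  have h := average_le_maximal f hl hx
  rwa [mul_comm, ← ENNReal.div_eq_inv_mul.trans (mul_comm _ _),
    ENNReal.div_le_iff' (volume_cube_ne_zero c hl) (volume_cube_ne_top c hl)] at h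

theorem maximal_le_iff {f : (Fin n → ℝ) → ℝ≥0∞} {x : Fin n → ℝ} {A : ℝ≥0∞} :
    maximal f x ≤ A ↔ ∀ c l, 0 < l → x ∈ cube c l →
      ∫⁻ y in cube c l, f y ≤ volume (cube c l) * A := by
  simp only [maximal, iSup_le_iff]
  refine forall₄_congr fun c l hl _ => ?_
  rw [← ENNReal.div_eq_inv_mul,
    ENNReal.div_le_iff' (volume_cube_ne_zero c hl) (volume_cube_ne_top c hl)]

theorem lt_maximal_iff {f : (Fin n → ℝ) → ℝ≥0∞} {x : Fin n → ℝ} {A : ℝ≥0∞} :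
    A < maximal f x ↔ ∃ c l, 0 < l ∧ x ∈ cube c l ∧
      volume (cube c l) * A < ∫⁻ y in cube c l, f y := by
  rw [← not_le, maximal_le_iff]
  push Not
  rfl

theorem maximal_mono {f g : (Fin n → ℝ) → ℝ≥0∞} (h : ∀ x, f x ≤ g x) (x : Fin n → ℝ) :
    maximal f x ≤ maximal g x :=
  maximal_le_iff.2 fun _ _ hl hx =>
    (lintegral_mono fun y => h y).trans (lintegral_cube_le_maximal g hl hx)

theorem maximal_congr_ae {f g : (Fin n → ℝ) → ℝ≥0∞} (h : f =ᵐ[volume] g) :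
    maximal f = maximal g := by
  funext x
  simp only [maximal]
  have key : ∀ s : Set (Fin n → ℝ), ∫⁻ y in s, f y = ∫⁻ y in s, g y := fun s =>
    lintegral_congr_ae (ae_restrict_of_ae h)
  simp only [key]

theorem maximal_add_le {f : (Fin n → ℝ) → ℝ≥0∞} (hf : Measurable f) (g : (Fin n → ℝ) → ℝ≥0∞)
    (x : Fin n → ℝ) : maximal (fun y => f y + g y) x ≤ maximal f x + maximal g x := by
  refine maximal_le_iff.2 fun c l hl hx => ?_
  rw [lintegral_add_left hf, mul_add]
  exact add_le_add (lintegral_cube_le_maximal f hl hx) (lintegral_cube_le_maximal g hl hx)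

theorem maximal_const_le (A : ℝ≥0∞) (x : Fin n → ℝ) : maximal (fun _ => A) x ≤ A :=
  maximal_le_iff.2 fun c l _ _ => by simp [mul_comm]

/-- A strict lower bound for an average survives a slight enlargement of the cube, and the enlarged
cube contains a neighbourhood of the point. No measurability of `f` is needed. -/
theorem lowerSemicontinuous_maximal (f : (Fin n → ℝ) → ℝ≥0∞) :
    LowerSemicontinuous (maximal f) := by
  intro x A hA
  obtain ⟨c, l, hl, hx, h⟩ := lt_maximal_iff.1 hA
  have hcont : Tendsto (fun m : ℝ => ENNReal.ofReal (m ^ n) * A) (𝓝[>] l)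
      (𝓝 (ENNReal.ofReal (l ^ n) * A)) := by
    refine ENNReal.Tendsto.mul_const ?_ (Or.inl ?_)
    · exact (ENNReal.continuous_ofReal.comp (continuous_pow n)).continuousAt.mono_left
        nhdsWithin_le_nhds
    · simpa using pow_pos hl n
  rw [volume_cube c hl.le] at h
  obtain ⟨m, hm, hlm⟩ := ((hcont.eventually_lt_const h).and self_mem_nhdsWithin).exists
  have hlm : l < m := hlm
  have hx' : dist x c ≤ l / 2 := hx
  filter_upwards [Metric.isOpen_ball.mem_nhds
    (show x ∈ Metric.ball c (m / 2) from lt_of_le_of_lt hx' (by linarith))] with y hy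
  refine lt_maximal_iff.2 ⟨c, m, hl.trans hlm, Metric.ball_subset_closedBall hy, ?_⟩
  rw [volume_cube c (hl.trans hlm).le]
  exact hm.trans_le (lintegral_mono_set (cube_subset_cube c hlm.le))

theorem measurable_maximal (f : (Fin n → ℝ) → ℝ≥0∞) : Measurable (maximal f) :=
  (lowerSemicontinuous_maximal f).measurable

theorem isOpen_lt_maximal (f : (Fin n → ℝ) → ℝ≥0∞) (A : ℝ≥0∞) : IsOpen {x | A < maximal f x} :=
  lowerSemicontinuous_iff_isOpen_preimage.1 (lowerSemicontinuous_maximal f) A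

/-- Lebesgue differentiation. -/
theorem ae_le_maximal {f : (Fin n → ℝ) → ℝ≥0∞} (hf : Measurable f) (hfi : ∫⁻ y, f y ≠ ∞) :
    ∀ᵐ x, f x ≤ maximal f x := by
  filter_upwards [(Besicovitch.vitaliFamily (volume : Measure (Fin n → ℝ))).ae_tendsto_lintegral_div
    hf.aemeasurable hfi] with x hx
  have h := hx.comp (Besicovitch.tendsto_filterAt volume x)
  refine le_of_tendsto h ?_
  filter_upwards [self_mem_nhdsWithin] with r hr
  have hr : 0 < r := hr
  have hc : Metric.closedBall x r = cube x (2 * r) := by rw [cube]; congr 1; ring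
  simp only [Function.comp, hc]
  rw [ENNReal.div_eq_inv_mul]
  exact average_le_maximal f (by positivity) (Metric.mem_closedBall_self (by positivity))

/-! ### The weighted weak type (1,1) bound. -/

/-- The weighted weak type `(1, 1)` inequality for the maximal function. -/
theorem weighted_weak_type (f w : (Fin n → ℝ) → ℝ≥0∞) (T : ℝ≥0∞) :
    T * (volume.withDensity w) {x | T < maximal f x} ≤
      ENNReal.ofReal (5 ^ n) * ∫⁻ y, f y * maximal w y := by
  -- Vitali's covering lemma needs bounded radii, so the level set is exhausted by the cubes of side
  -- at most `N`.
  set s : ℕ → Set (Fin n → ℝ) := fun N => ⋃ a ∈ {a : (Fin n → ℝ) × ℝ | 0 < a.2 ∧ a.2 ≤ N ∧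
    volume (cube a.1 a.2) * T < ∫⁻ y in cube a.1 a.2, f y}, cube a.1 a.2 with hs
  have hunion : {x | T < maximal f x} = ⋃ N, s N := by
    ext x
    simp only [hs, mem_ofPred_eq, lt_maximal_iff, mem_iUnion]
    constructor
    · rintro ⟨c, l, hl, hx, h⟩
      obtain ⟨N, hN⟩ := exists_nat_ge l
      exact ⟨N, (c, l), ⟨hl, hN, h⟩, hx⟩
    · rintro ⟨N, ⟨c, l⟩, ⟨hl, -, h⟩, hx⟩
      exact ⟨c, l, hl, hx, h⟩
  have hmono : Monotone s := by
    intro N N' h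
    refine biUnion_subset_biUnion_left ?_
    rintro a ⟨h1, h2, h3⟩
    exact ⟨h1, h2.trans (by exact_mod_cast h), h3⟩
  rw [hunion, hmono.measure_iUnion, ENNReal.mul_iSup]
  refine iSup_le fun N => ?_
  obtain ⟨u, hut, hdisj, hcov⟩ := Vitali.exists_disjoint_subfamily_covering_enlargement_closedBall
    {a : (Fin n → ℝ) × ℝ | 0 < a.2 ∧ a.2 ≤ N ∧
      volume (cube a.1 a.2) * T < ∫⁻ y in cube a.1 a.2, f y}
    (fun a => a.1) (fun a => a.2 / 2) (N / 2) (fun a ha => by have := ha.2.1; linarith) 5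
    (by norm_num)
  have hcount : u.Countable := by
    refine hdisj.countable_of_nonempty_interior fun a ha => ⟨a.1, ?_⟩
    exact mem_interior_iff_mem_nhds.2 (Metric.closedBall_mem_nhds _ (half_pos (hut ha).1))
  have hsub : s N ⊆ ⋃ a ∈ u, cube a.1 (5 * a.2) := by
    refine iUnion₂_subset fun a ha => ?_
    obtain ⟨b, hb, hab⟩ := hcov a ha
    refine subset_biUnion_of_mem (u := fun b : (Fin n → ℝ) × ℝ => cube b.1 (5 * b.2)) hb |>.trans' ?_
    simpa only [cube, mul_div_assoc] using hab
  have hball : ∀ a ∈ u, T * (volume.withDensity w) (cube a.1 (5 * a.2)) ≤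
      ENNReal.ofReal (5 ^ n) * ∫⁻ y in cube a.1 a.2, f y * maximal w y := by
    rintro ⟨c, l⟩ ha
    obtain ⟨hl, -, hT⟩ := hut ha
    simp only at hl hT ⊢
    have h5 : 0 < 5 * l := by positivity
    rw [withDensity_apply _ (measurableSet_cube _ _)]
    -- `A` is the mean of `w` over the enlarged cube. That cube contains the small one, so `A ≤
    -- maximal w y` at every point `y` over which `f` is integrated.
    set A := (volume (cube c (5 * l)))⁻¹ * ∫⁻ y in cube c (5 * l), w y with hA
    have hwA : ∫⁻ y in cube c (5 * l), w y = volume (cube c (5 * l)) * A := by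
      rw [hA, ← mul_assoc, ENNReal.mul_inv_cancel (volume_cube_ne_zero c h5)
        (volume_cube_ne_top c h5), one_mul]
    have hvol : volume (cube c (5 * l)) = ENNReal.ofReal (5 ^ n) * volume (cube c l) := by
      rw [volume_cube c h5.le, volume_cube c hl.le, mul_pow, ENNReal.ofReal_mul (by positivity)]
    calc T * ∫⁻ y in cube c (5 * l), w y
        = ENNReal.ofReal (5 ^ n) * (A * (volume (cube c l) * T)) := by rw [hwA, hvol]; ring
      _ ≤ ENNReal.ofReal (5 ^ n) * (A * ∫⁻ y in cube c l, f y) := by gcongr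
      _ ≤ ENNReal.ofReal (5 ^ n) * ∫⁻ y in cube c l, A * f y := by
          gcongr; exact lintegral_const_mul_le _ _
      _ ≤ _ := by
          gcongr ENNReal.ofReal (5 ^ n) * ?_
          refine setLIntegral_mono' (measurableSet_cube c l) fun y hy => ?_
          rw [mul_comm]
          gcongr
          exact average_le_maximal w h5 (cube_subset_cube c (by linarith) hy)
  calc T * (volume.withDensity w) (s N)
      ≤ T * ∑' a : u, (volume.withDensity w) (cube a.1.1 (5 * a.1.2)) := by
        gcongr
        exact (measure_mono hsub).trans (measure_biUnion_le _ hcount _)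
    _ = ∑' a : u, T * (volume.withDensity w) (cube a.1.1 (5 * a.1.2)) :=
        ENNReal.tsum_mul_left.symm
    _ ≤ ∑' a : u, ENNReal.ofReal (5 ^ n) * ∫⁻ y in cube a.1.1 a.1.2, f y * maximal w y :=
        ENNReal.tsum_le_tsum fun a => hball a.1 a.2
    _ = ENNReal.ofReal (5 ^ n) * ∑' a : u, ∫⁻ y in cube a.1.1 a.1.2, f y * maximal w y :=
        ENNReal.tsum_mul_left
    _ ≤ _ := by
        gcongr
        rw [← lintegral_biUnion hcount (fun a _ => measurableSet_cube _ _) hdisj]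
        exact setLIntegral_le_lintegral _ _

theorem weak_type (f : (Fin n → ℝ) → ℝ≥0∞) (T : ℝ≥0∞) :
    T * volume {x | T < maximal f x} ≤ ENNReal.ofReal (5 ^ n) * ∫⁻ y, f y := by
  have h := weighted_weak_type f (fun _ => 1) T
  have h1 : (volume : Measure (Fin n → ℝ)).withDensity (fun _ => 1) = volume := withDensity_one
  rw [h1] at h
  refine h.trans ?_
  gcongr with y
  exact (mul_le_mul_right (maximal_const_le 1 y) _).trans_eq (mul_one _)

/-! ### Layer cake formula and Marcinkiewicz interpolation. -/

section Interpolation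

theorem lintegral_Ioo_rpow {r : ℝ} (hr : 0 < r) {b : ℝ} (hb : 0 ≤ b) :
    ∫⁻ t in Ioo 0 b, ENNReal.ofReal (t ^ (r - 1)) = ENNReal.ofReal (b ^ r / r) := by
  have hint : IntegrableOn (fun t : ℝ => t ^ (r - 1)) (Ioc 0 b) :=
    (intervalIntegrable_iff_integrableOn_Ioc_of_le hb).1
      (intervalIntegral.intervalIntegrable_rpow' (by linarith))
  rw [← ofReal_integral_eq_lintegral_ofReal (hint.mono_set Ioo_subset_Ioc_self), ←
    integral_Ioc_eq_integral_Ioo, ← intervalIntegral.integral_of_le hb,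
    integral_rpow (Or.inl (by linarith))]
  · rw [sub_add_cancel, Real.zero_rpow hr.ne', sub_zero]
  · filter_upwards [ae_restrict_mem measurableSet_Ioo] with t ht
    exact Real.rpow_nonneg ht.1.le _

theorem lintegral_Ioi_rpow {r : ℝ} (hr : 0 < r) {b : ℝ} (hb : 0 < b) :
    ∫⁻ t in Ioi b, ENNReal.ofReal (t ^ (-r - 1)) = ENNReal.ofReal (b ^ (-r) / r) := by
  rw [← ofReal_integral_eq_lintegral_ofReal (integrableOn_Ioi_rpow_of_lt (by linarith) hb),
    integral_Ioi_rpow_of_lt (by linarith) hb]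
  · congr 1
    rw [sub_add_cancel]; field_simp
  · filter_upwards [ae_restrict_mem measurableSet_Ioi] with t ht
    exact Real.rpow_nonneg (hb.trans ht).le _

/-- This is a^r = r ∫_0^a t^{r-1} dt. It is proved for finite b ≤ a, and unbounded b then force the
right side to be infinite when a = ∞. -/
theorem rpow_le_lintegral_indicator {r : ℝ} (hr : 0 < r) (a : ℝ≥0∞) :
    a ^ r ≤ ENNReal.ofReal r * ∫⁻ t in Ioi (0 : ℝ),
      {t : ℝ | ENNReal.ofReal t < a}.indicator (fun t => ENNReal.ofReal (t ^ (r - 1))) t := by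
  have key : ∀ b : ℝ≥0, (b : ℝ≥0∞) ≤ a → (b : ℝ≥0∞) ^ r ≤ ENNReal.ofReal r *
      ∫⁻ t in Ioi (0 : ℝ),
      {t : ℝ | ENNReal.ofReal t < a}.indicator (fun t => ENNReal.ofReal (t ^ (r - 1))) t := by
    intro b hb
    have h : ENNReal.ofReal ((b : ℝ) ^ r / r) ≤ ∫⁻ t in Ioi (0 : ℝ),
        {t : ℝ | ENNReal.ofReal t < a}.indicator (fun t => ENNReal.ofReal (t ^ (r - 1))) t := by
      rw [← lintegral_Ioo_rpow hr b.coe_nonneg]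
      calc _ = ∫⁻ t in Ioo (0 : ℝ) b, {t : ℝ | ENNReal.ofReal t < a}.indicator
            (fun t => ENNReal.ofReal (t ^ (r - 1))) t := by
            refine setLIntegral_congr_fun measurableSet_Ioo fun t ht => ?_
            rw [indicator_of_mem]
            refine lt_of_lt_of_le ?_ hb
            rw [← ENNReal.ofReal_coe_nnreal]
            exact (ENNReal.ofReal_lt_ofReal_iff (ht.1.trans ht.2)).2 ht.2
        _ ≤ _ := lintegral_mono_set fun t ht => ht.1
    calc (b : ℝ≥0∞) ^ r = ENNReal.ofReal r * ENNReal.ofReal ((b : ℝ) ^ r / r) := by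
          rw [← ENNReal.ofReal_mul hr.le, mul_div_cancel₀ _ hr.ne',
            ← ENNReal.ofReal_rpow_of_nonneg b.coe_nonneg hr.le, ENNReal.ofReal_coe_nnreal]
      _ ≤ _ := by gcongr
  rcases eq_or_ne a ∞ with rfl | ha
  · rw [ENNReal.top_rpow_of_pos hr, top_le_iff]
    refine ENNReal.eq_top_of_forall_nnreal_le fun c => ?_
    have h := key (c ^ (1 / r)) le_top
    rwa [ENNReal.coe_rpow_of_nonneg _ (by positivity), ← ENNReal.rpow_mul,
      one_div_mul_cancel hr.ne', ENNReal.rpow_one] at h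
  · lift a to ℝ≥0 using ha
    exact key a le_rfl

theorem lintegral_indicator_lt_le {r : ℝ} (hr : 0 < r) (a : ℝ≥0∞) :
    ∫⁻ t in Ioi (0 : ℝ),
      {t : ℝ | ENNReal.ofReal t < a}.indicator (fun t => ENNReal.ofReal (t ^ (r - 1))) t ≤
      (ENNReal.ofReal r)⁻¹ * a ^ r := by
  have hr' : ENNReal.ofReal r ≠ 0 := by simpa using hr
  rcases eq_or_ne a ∞ with rfl | ha
  · rw [ENNReal.top_rpow_of_pos hr, ENNReal.mul_top (by simp)]
    exact le_top
  lift a to ℝ≥0 using ha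
  rw [lintegral_indicator (measurableSet_lt (by fun_prop) (by fun_prop)),
    Measure.restrict_restrict (measurableSet_lt (by fun_prop) (by fun_prop))]
  refine (lintegral_mono_set (t := Ioo 0 (a : ℝ)) ?_).trans ?_
  · rintro t ⟨h1, h2⟩
    have h1 : ENNReal.ofReal t < a := h1
    rw [← ENNReal.ofReal_coe_nnreal] at h1
    exact ⟨h2, (ENNReal.ofReal_lt_ofReal_iff_of_nonneg (le_of_lt h2)).1 h1⟩
  · rw [lintegral_Ioo_rpow hr a.coe_nonneg, div_eq_inv_mul, ENNReal.ofReal_mul (by positivity),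
      ENNReal.ofReal_inv_of_pos hr, ← ENNReal.ofReal_rpow_of_nonneg a.coe_nonneg hr.le,
      ENNReal.ofReal_coe_nnreal]

/-- The integral of t^{p-q-1} over t ≥ a is a^{p-q}/(q-p). The factor a^q stays outside so that the
degenerate cases hold too: it vanishes at a = 0, and the domain is empty at a = ∞. -/
theorem mul_lintegral_indicator_ge_le {p q : ℝ} (hp : 0 < p) (hpq : p < q) (a : ℝ≥0∞) :
    a ^ q * ∫⁻ t in Ioi (0 : ℝ),
      {t : ℝ | a ≤ ENNReal.ofReal t}.indicator (fun t => ENNReal.ofReal (t ^ (-(q - p) - 1))) t ≤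
      (ENNReal.ofReal (q - p))⁻¹ * a ^ p := by
  have hr : 0 < q - p := by linarith
  rcases eq_or_ne a ∞ with rfl | ha
  · simp
  rcases eq_or_ne a 0 with rfl | ha0
  · rw [ENNReal.zero_rpow_of_pos (by linarith)]; simp
  lift a to ℝ≥0 using ha
  have ha0 : 0 < (a : ℝ) := by
    have : a ≠ 0 := by exact_mod_cast ha0
    positivity
  rw [lintegral_indicator (measurableSet_le (by fun_prop) (by fun_prop)),
    Measure.restrict_restrict (measurableSet_le (by fun_prop) (by fun_prop))]
  have hsub : {t : ℝ | (a : ℝ≥0∞) ≤ ENNReal.ofReal t} ∩ Ioi 0 ⊆ Ici (a : ℝ) := by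
    rintro t ⟨h1, h2⟩
    have h1 : (a : ℝ≥0∞) ≤ ENNReal.ofReal t := h1
    rw [← ENNReal.ofReal_coe_nnreal] at h1
    exact (ENNReal.ofReal_le_ofReal_iff (le_of_lt h2)).1 h1
  calc _ ≤ (a : ℝ≥0∞) ^ q * ∫⁻ t in Ici (a : ℝ), ENNReal.ofReal (t ^ (-(q - p) - 1)) := by
        gcongr
    _ = _ := by
        rw [setLIntegral_congr Ioi_ae_eq_Ici.symm, lintegral_Ioi_rpow hr ha0, div_eq_inv_mul,
          ENNReal.ofReal_mul (by positivity), ENNReal.ofReal_inv_of_pos hr, mul_left_comm,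
          ← ENNReal.ofReal_coe_nnreal, ENNReal.ofReal_rpow_of_pos ha0,
          ← ENNReal.ofReal_mul (by positivity), ← Real.rpow_add ha0,
          ENNReal.ofReal_rpow_of_pos ha0]
        ring_nf

variable {α : Type*} [MeasurableSpace α] {μ ν : Measure α} [SFinite μ] [SFinite ν]

theorem lintegral_rpow_le_layercake {S : α → ℝ≥0∞} (hS : Measurable S) {p : ℝ} (hp : 0 < p) :
    ∫⁻ x, S x ^ p ∂μ ≤ ENNReal.ofReal p * ∫⁻ t in Ioi (0 : ℝ),
      ENNReal.ofReal (t ^ (p - 1)) * μ {x | ENNReal.ofReal t < S x} := by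
  have hD : MeasurableSet {z : α × ℝ | ENNReal.ofReal z.2 < S z.1} :=
    measurableSet_lt (by fun_prop) (by fun_prop)
  have hm : Measurable (fun z : α × ℝ => {z : α × ℝ | ENNReal.ofReal z.2 < S z.1}.indicator
      (fun z => ENNReal.ofReal (z.2 ^ (p - 1))) z) :=
    Measurable.indicator (by fun_prop) hD
  calc ∫⁻ x, S x ^ p ∂μ ≤ ∫⁻ x, (ENNReal.ofReal p * ∫⁻ t in Ioi (0 : ℝ),
        {z : α × ℝ | ENNReal.ofReal z.2 < S z.1}.indicator
          (fun z => ENNReal.ofReal (z.2 ^ (p - 1))) (x, t)) ∂μ :=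
        lintegral_mono fun x => rpow_le_lintegral_indicator hp (S x)
    _ = ENNReal.ofReal p * ∫⁻ t in Ioi (0 : ℝ), ∫⁻ x,
        {z : α × ℝ | ENNReal.ofReal z.2 < S z.1}.indicator
          (fun z => ENNReal.ofReal (z.2 ^ (p - 1))) (x, t) ∂μ := by
        rw [lintegral_const_mul _ hm.lintegral_prod_right', lintegral_lintegral_swap hm.aemeasurable]
    _ = _ := by
        congr 2 with t
        have : (fun x => {z : α × ℝ | ENNReal.ofReal z.2 < S z.1}.indicator
            (fun z => ENNReal.ofReal (z.2 ^ (p - 1))) (x, t)) =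
            {x | ENNReal.ofReal t < S x}.indicator fun _ => ENNReal.ofReal (t ^ (p - 1)) := rfl
        rw [this, lintegral_indicator_const (measurableSet_lt (by fun_prop) (by fun_prop))]

/-- Marcinkiewicz interpolation between weak type `(1, 1)` and weak type `(q, q)`. -/
theorem lintegral_rpow_le_of_weak_bounds {S g : α → ℝ≥0∞} (hS : Measurable S) (hg : Measurable g)
    {p q : ℝ} (hp : 1 < p) (hpq : p < q) {A B : ℝ≥0∞}
    (h : ∀ T : ℝ≥0, 0 < T → T * μ {x | 2 * T < S x} ≤
      A * ∫⁻ x, {x | T < g x}.indicator g x ∂ν +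
      B * ((T : ℝ≥0∞) ^ (1 - q) * ∫⁻ x, {x | g x ≤ T}.indicator (fun x => g x ^ q) x ∂ν)) :
    ∫⁻ x, S x ^ p ∂μ ≤ 2 ^ p * (ENNReal.ofReal p *
      (A * (ENNReal.ofReal (p - 1))⁻¹ + B * (ENNReal.ofReal (q - p))⁻¹)) * ∫⁻ x, g x ^ p ∂ν := by
  have hp0 : 0 < p := by linarith
  have hD : MeasurableSet {z : α × ℝ | ENNReal.ofReal z.2 < g z.1} :=
    measurableSet_lt (by fun_prop) (by fun_prop)
  have hE : MeasurableSet {z : α × ℝ | g z.1 ≤ ENNReal.ofReal z.2} :=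
    measurableSet_le (by fun_prop) (by fun_prop)
  -- `G` and `H` are the integrands of the two weak bounds at height t, multiplied by t^{p-2}. By
  -- Tonelli they may be integrated in t first, and each then yields a multiple of g^p.
  set G : α × ℝ → ℝ≥0∞ := {z : α × ℝ | ENNReal.ofReal z.2 < g z.1}.indicator
    (fun z => g z.1 * ENNReal.ofReal (z.2 ^ (p - 1 - 1))) with hG
  set H : α × ℝ → ℝ≥0∞ := {z : α × ℝ | g z.1 ≤ ENNReal.ofReal z.2}.indicator
    (fun z => g z.1 ^ q * ENNReal.ofReal (z.2 ^ (-(q - p) - 1))) with hH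
  have hGm : Measurable G := Measurable.indicator (by fun_prop) hD
  have hHm : Measurable H := Measurable.indicator (by fun_prop) hE
  have hstep : ∀ t ∈ Ioi (0 : ℝ),
      ENNReal.ofReal (t ^ (p - 1)) * μ {x | ENNReal.ofReal t < 2⁻¹ * S x} ≤
      A * ∫⁻ x, G (x, t) ∂ν + B * ∫⁻ x, H (x, t) ∂ν := by
    intro t ht
    have ht : 0 < t := ht
    have h1 := h t.toNNReal (Real.toNNReal_pos.2 ht)
    have hco : ((t.toNNReal : ℝ≥0) : ℝ≥0∞) = ENNReal.ofReal t := rfl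
    rw [hco] at h1
    have hset : {x | ENNReal.ofReal t < 2⁻¹ * S x} = {x | 2 * ENNReal.ofReal t < S x} := by
      ext x
      simp only [mem_ofPred_eq]
      rw [← ENNReal.div_eq_inv_mul, ENNReal.lt_div_iff_mul_lt (by simp) (by simp), mul_comm]
    have e1 : ENNReal.ofReal (t ^ (p - 1)) = ENNReal.ofReal (t ^ (p - 1 - 1)) * ENNReal.ofReal t := by
      rw [← ENNReal.ofReal_mul (by positivity), Real.rpow_sub_one ht.ne' (p - 1),
        div_mul_cancel₀ _ ht.ne']
    have e2 : ENNReal.ofReal (t ^ (p - 1 - 1)) * ENNReal.ofReal t ^ (1 - q) =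
        ENNReal.ofReal (t ^ (-(q - p) - 1)) := by
      rw [ENNReal.ofReal_rpow_of_pos ht, ← ENNReal.ofReal_mul (by positivity), ← Real.rpow_add ht]
      congr 2; ring
    have e3 : ∫⁻ x, G (x, t) ∂ν = ENNReal.ofReal (t ^ (p - 1 - 1)) *
        ∫⁻ x, {x | ENNReal.ofReal t < g x}.indicator g x ∂ν := by
      rw [← lintegral_const_mul _ (hg.indicator (measurableSet_lt (by fun_prop) (by fun_prop)))]
      refine lintegral_congr fun x => ?_
      by_cases hx : ENNReal.ofReal t < g x <;> simp [hG, indicator, hx, mul_comm]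
    have e4 : ∫⁻ x, H (x, t) ∂ν = ENNReal.ofReal (t ^ (-(q - p) - 1)) *
        ∫⁻ x, {x | g x ≤ ENNReal.ofReal t}.indicator (fun x => g x ^ q) x ∂ν := by
      rw [← lintegral_const_mul _ (Measurable.indicator (by fun_prop)
        (measurableSet_le (by fun_prop) (by fun_prop)))]
      refine lintegral_congr fun x => ?_
      by_cases hx : g x ≤ ENNReal.ofReal t <;> simp [hH, indicator, hx, mul_comm]
    rw [hset, e1, mul_assoc, e3, e4, ← e2]
    refine (mul_le_mul_right h1 _).trans_eq ?_
    ring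
  -- The hypothesis controls the level 2T, so the layer cake formula is applied to S/2 at the cost
  -- of 2^p.
  calc ∫⁻ x, S x ^ p ∂μ = 2 ^ p * ∫⁻ x, (2⁻¹ * S x) ^ p ∂μ := by
        rw [← lintegral_const_mul _ (by fun_prop)]
        refine lintegral_congr fun x => ?_
        rw [← ENNReal.mul_rpow_of_nonneg _ _ hp0.le, ← mul_assoc, ENNReal.mul_inv_cancel (by simp)
          (by simp), one_mul]
    _ ≤ 2 ^ p * (ENNReal.ofReal p * ∫⁻ t in Ioi (0 : ℝ),
        ENNReal.ofReal (t ^ (p - 1)) * μ {x | ENNReal.ofReal t < 2⁻¹ * S x}) := by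
        gcongr
        exact lintegral_rpow_le_layercake (by fun_prop) hp0
    _ ≤ 2 ^ p * (ENNReal.ofReal p * ∫⁻ t in Ioi (0 : ℝ),
        (A * ∫⁻ x, G (x, t) ∂ν + B * ∫⁻ x, H (x, t) ∂ν)) := by
        gcongr 2 ^ p * (ENNReal.ofReal p * ?_)
        exact setLIntegral_mono' measurableSet_Ioi hstep
    _ = 2 ^ p * (ENNReal.ofReal p * (A * (∫⁻ x, (∫⁻ t in Ioi (0 : ℝ), G (x, t)) ∂ν) +
        B * ∫⁻ x, (∫⁻ t in Ioi (0 : ℝ), H (x, t)) ∂ν)) := by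
        rw [lintegral_add_left (hGm.lintegral_prod_left'.const_mul A),
          lintegral_const_mul _ hGm.lintegral_prod_left',
          lintegral_const_mul _ hHm.lintegral_prod_left',
          lintegral_lintegral_swap (f := fun x t => G (x, t)) hGm.aemeasurable,
          lintegral_lintegral_swap (f := fun x t => H (x, t)) hHm.aemeasurable]
    _ ≤ 2 ^ p * (ENNReal.ofReal p * (A * (∫⁻ x, (ENNReal.ofReal (p - 1))⁻¹ * g x ^ p ∂ν) +
        B * ∫⁻ x, (ENNReal.ofReal (q - p))⁻¹ * g x ^ p ∂ν)) := by
        gcongr with x x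
        · calc ∫⁻ t in Ioi (0 : ℝ), G (x, t) = ∫⁻ t in Ioi (0 : ℝ), g x *
              {t : ℝ | ENNReal.ofReal t < g x}.indicator
                (fun t => ENNReal.ofReal (t ^ (p - 1 - 1))) t := by
                refine lintegral_congr fun t => ?_
                by_cases hx : ENNReal.ofReal t < g x <;> simp [hG, indicator, hx]
            _ = g x * ∫⁻ t in Ioi (0 : ℝ), {t : ℝ | ENNReal.ofReal t < g x}.indicator
                (fun t => ENNReal.ofReal (t ^ (p - 1 - 1))) t :=
                lintegral_const_mul _ (Measurable.indicator (by fun_prop)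
                  (measurableSet_lt (by fun_prop) (by fun_prop)))
            _ ≤ g x * ((ENNReal.ofReal (p - 1))⁻¹ * g x ^ (p - 1)) := by
                gcongr
                exact lintegral_indicator_lt_le (by linarith) _
            _ = (ENNReal.ofReal (p - 1))⁻¹ * (g x ^ (1 : ℝ) * g x ^ (p - 1)) := by
                rw [ENNReal.rpow_one]; ring
            _ = _ := by
                rw [← ENNReal.rpow_add_of_nonneg _ _ zero_le_one (by linarith), add_sub_cancel]
        · calc ∫⁻ t in Ioi (0 : ℝ), H (x, t) = ∫⁻ t in Ioi (0 : ℝ), g x ^ q *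
              {t : ℝ | g x ≤ ENNReal.ofReal t}.indicator
                (fun t => ENNReal.ofReal (t ^ (-(q - p) - 1))) t := by
                refine lintegral_congr fun t => ?_
                by_cases hx : g x ≤ ENNReal.ofReal t <;> simp [hH, indicator, hx]
            _ = g x ^ q * ∫⁻ t in Ioi (0 : ℝ), {t : ℝ | g x ≤ ENNReal.ofReal t}.indicator
                (fun t => ENNReal.ofReal (t ^ (-(q - p) - 1))) t :=
                lintegral_const_mul _ (Measurable.indicator (by fun_prop)
                  (measurableSet_le (by fun_prop) (by fun_prop)))
            _ ≤ _ := mul_lintegral_indicator_ge_le hp0 hpq _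
    _ = _ := by
        rw [lintegral_const_mul _ (by fun_prop), lintegral_const_mul _ (by fun_prop)]
        ring

end Interpolation

/-! ### The l_q norm and Minkowski's inequality. -/

section SequenceNorm

variable {q : ℝ≥0∞}

theorem lqNorm_top (a : ℤ → ℝ≥0∞) : lqNorm ∞ a = ⨆ j, a j := by
  simp [lqNorm]

theorem lqNorm_ofReal {r : ℝ} (hr : 0 < r) (a : ℤ → ℝ≥0∞) :
    lqNorm (ENNReal.ofReal r) a = (∑' j, a j ^ r) ^ (1 / r) := by
  simp [lqNorm, ENNReal.toReal_ofReal hr.le]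

theorem lqNorm_enorm {ε : Type*} [ENorm ε] (a : ℤ → ε) : lqNorm q a = lqNorm q fun j => ‖a j‖ₑ := by
  simp [lqNorm]

theorem lqNorm_ofReal_rpow {r : ℝ} (hr : 0 < r) (a : ℤ → ℝ≥0∞) :
    lqNorm (ENNReal.ofReal r) a ^ r = ∑' j, a j ^ r := by
  rw [lqNorm_ofReal hr, ← ENNReal.rpow_mul, one_div_mul_cancel hr.ne', ENNReal.rpow_one]

theorem eq_top_or_exists_ofReal (hq : 1 < q) : q = ∞ ∨ ∃ r : ℝ, 1 < r ∧ q = ENNReal.ofReal r := by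
  rcases eq_or_ne q ∞ with h | h
  · exact Or.inl h
  · refine Or.inr ⟨q.toReal, ?_, (ENNReal.ofReal_toReal h).symm⟩
    simpa using (ENNReal.toReal_lt_toReal ENNReal.one_ne_top h).2 hq

theorem lqNorm_mono {a b : ℤ → ℝ≥0∞} (h : ∀ j, a j ≤ b j) : lqNorm q a ≤ lqNorm q b := by
  simp only [lqNorm, enorm_eq_self]
  split_ifs
  · exact iSup_mono h
  · gcongr with j
    exact h j

theorem lqNorm_const_mul (hq : 1 < q) (c : ℝ≥0∞) (a : ℤ → ℝ≥0∞) :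
    lqNorm q (fun j => c * a j) = c * lqNorm q a := by
  rcases eq_top_or_exists_ofReal hq with rfl | ⟨r, hr, rfl⟩
  · rw [lqNorm_top, lqNorm_top, ENNReal.mul_iSup]
  · have hr0 : 0 < r := by linarith
    simp only [lqNorm_ofReal hr0, ENNReal.mul_rpow_of_nonneg _ _ hr0.le, ENNReal.tsum_mul_left]
    rw [ENNReal.mul_rpow_of_nonneg _ _ (by positivity), ← ENNReal.rpow_mul,
      mul_one_div_cancel hr0.ne', ENNReal.rpow_one]

theorem measurable_lqNorm {α : Type*} [MeasurableSpace α] {f : ℤ → α → ℝ≥0∞}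
    (hf : ∀ j, Measurable (f j)) : Measurable fun x => lqNorm q fun j => f j x := by
  simp only [lqNorm, enorm_eq_self]
  split_ifs
  · exact Measurable.iSup hf
  · exact (Measurable.tsum fun j => (hf j).pow_const _).pow_const _

theorem le_lqNorm (hq : 1 < q) (a : ℤ → ℝ≥0∞) (j : ℤ) : a j ≤ lqNorm q a := by
  rcases eq_top_or_exists_ofReal hq with rfl | ⟨r, hr, rfl⟩
  · rw [lqNorm_top]; exact le_iSup a j
  · have hr0 : 0 < r := by linarith
    rw [lqNorm_ofReal hr0, one_div, ENNReal.le_rpow_inv_iff hr0]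
    exact ENNReal.le_tsum (f := fun j => a j ^ r) j

/-- Minkowski's integral inequality. -/
theorem lqNorm_lintegral_le (hq : 1 < q) {α : Type*} [MeasurableSpace α] {μ : Measure α}
    {f : ℤ → α → ℝ≥0∞} (hf : ∀ j, Measurable (f j)) :
    lqNorm q (fun j => ∫⁻ x, f j x ∂μ) ≤ ∫⁻ x, lqNorm q (fun j => f j x) ∂μ := by
  have hle : ∀ j, ∫⁻ x, f j x ∂μ ≤ ∫⁻ x, lqNorm q (fun j => f j x) ∂μ := fun j =>
    lintegral_mono fun x => le_lqNorm hq (fun j => f j x) j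
  rcases eq_top_or_exists_ofReal hq with rfl | ⟨r, hr, rfl⟩
  · rw [lqNorm_top]
    exact iSup_le hle
  have hr0 : 0 < r := by linarith
  rcases eq_or_ne (∫⁻ x, lqNorm (ENNReal.ofReal r) (fun j => f j x) ∂μ) ∞ with h | hfin
  · rw [h]; exact le_top
  set I : ℤ → ℝ≥0∞ := fun j => ∫⁻ x, f j x ∂μ with hI
  have hIfin : ∀ j, I j ≠ ∞ := fun j => ne_top_of_le_ne_top hfin (hle j)
  rw [lqNorm_ofReal hr0, one_div, ENNReal.rpow_inv_le_iff hr0, ENNReal.tsum_eq_iSup_sum]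
  refine iSup_le fun s => ?_
  have hconj : r.HolderConjugate (r / (r - 1)) := Real.HolderConjugate.conjExponent hr
  -- Restricting to a finite set of indices, each with finite integral, makes `A` finite, so its
  -- power can be cancelled at the end.
  set A := ∑ j ∈ s, I j ^ r with hA
  have hAfin : A ≠ ∞ := ENNReal.sum_ne_top.2 fun j _ => ENNReal.rpow_ne_top_of_nonneg hr0.le (hIfin j)
  rcases eq_or_ne A 0 with h0 | h0
  · rw [h0]; exact zero_le
  -- Duality: write I_j^r = I_j^{r-1} ∫ f_j and apply Hölder to the sum under the integral. Since
  -- (r-1)r' = r for the conjugate exponent r', the first factor is a power of `A`.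
  have key : A ≤ A ^ (1 / (r / (r - 1))) * ∫⁻ x, lqNorm (ENNReal.ofReal r) (fun j => f j x) ∂μ := by
    calc A = ∑ j ∈ s, ∫⁻ x, I j ^ (r - 1) * f j x ∂μ := by
          refine Finset.sum_congr rfl fun j _ => ?_
          rw [lintegral_const_mul _ (hf j)]
          change I j ^ r = I j ^ (r - 1) * I j
          nth_rw 3 [← ENNReal.rpow_one (I j)]
          rw [← ENNReal.rpow_add_of_nonneg _ _ (by linarith) zero_le_one, sub_add_cancel]
      _ = ∫⁻ x, ∑ j ∈ s, I j ^ (r - 1) * f j x ∂μ :=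
          (lintegral_finsetSum _ fun j _ => (hf j).const_mul _).symm
      _ ≤ ∫⁻ x, A ^ (1 / (r / (r - 1))) * lqNorm (ENNReal.ofReal r) (fun j => f j x) ∂μ := by
          refine lintegral_mono fun x => ?_
          refine (ENNReal.inner_le_Lp_mul_Lq s _ _ hconj.symm).trans ?_
          gcongr ?_ * ?_
          · refine ENNReal.rpow_le_rpow (Finset.sum_le_sum fun j _ => ?_) ?_
            · rw [← ENNReal.rpow_mul, mul_div_cancel₀ _ (by linarith)]
            · have := hconj.symm.pos; positivity
          · rw [lqNorm_ofReal hr0]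
            gcongr
            exact ENNReal.sum_le_tsum s
      _ = _ := lintegral_const_mul _ (measurable_lqNorm hf)
  have e : A = A ^ (1 / (r / (r - 1))) * A ^ r⁻¹ := by
    rw [← ENNReal.rpow_add _ _ h0 hAfin]
    have : 1 / (r / (r - 1)) + r⁻¹ = 1 := by field_simp; ring
    rw [this, ENNReal.rpow_one]
  have hne0 : A ^ (1 / (r / (r - 1))) ≠ 0 := by
    simp [ENNReal.rpow_eq_zero_iff, h0, hAfin]
  have hnetop : A ^ (1 / (r / (r - 1))) ≠ ∞ := by
    simp [ENNReal.rpow_eq_top_iff, h0, hAfin]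
  rw [← ENNReal.rpow_inv_le_iff hr0]
  nth_rw 1 [e] at key
  exact (ENNReal.mul_le_mul_iff_right hne0 hnetop).1 key

/-- The triangle inequality is Minkowski's integral inequality for counting measure on two points.
-/
theorem lqNorm_add_le (hq : 1 < q) (a b : ℤ → ℝ≥0∞) :
    lqNorm q (fun j => a j + b j) ≤ lqNorm q a + lqNorm q b := by
  have h := lqNorm_lintegral_le hq (μ := (Measure.count : Measure Bool))
    (f := fun j i => if i then a j else b j) (fun j => measurable_of_finite _)
  simpa [lintegral_count, tsum_fintype] using h

end SequenceNorm

/-! ### Strong type bounds for the scalar maximal operator. -/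

/-- The part of `f` below `T` has maximal function at most `T`, so only the part above `T` can lift
the total past `2 * T`. This plays the role of the L^∞ endpoint in the interpolation. -/
theorem setOf_two_mul_lt_maximal_subset {f : (Fin n → ℝ) → ℝ≥0∞} (hf : Measurable f) (T : ℝ≥0) :
    {x | 2 * T < maximal f x} ⊆ {x | T < maximal ({x | T < f x}.indicator f) x} := by
  intro x hx
  have hx : 2 * T < maximal f x := hx
  by_contra! h
  have h : maximal ({x | T < f x}.indicator f) x ≤ T := not_lt.1 h
  refine hx.not_ge ?_
  calc maximal f x ≤ maximal (fun y => {x | T < f x}.indicator f y + T) x := by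
        refine maximal_mono (fun y => ?_) x
        by_cases hy : T < f y
        · simp [indicator, hy]
        · rw [indicator_of_notMem (by exact hy), zero_add]
          exact not_lt.1 hy
    _ ≤ maximal ({x | T < f x}.indicator f) x + maximal (fun _ => (T : ℝ≥0∞)) x :=
        maximal_add_le (hf.indicator (measurableSet_lt (by fun_prop) (by fun_prop))) _ x
    _ ≤ T + T := add_le_add h (maximal_const_le _ x)
    _ = 2 * T := (two_mul _).symm

/-- The Fefferman–Stein weighted inequality for the scalar maximal function. -/
theorem weighted_strong_type (n : ℕ) {p : ℝ} (hp : 1 < p) :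
    ∃ C : ℝ≥0, ∀ f w : (Fin n → ℝ) → ℝ≥0∞, Measurable f → Measurable w →
      ∫⁻ x, maximal f x ^ p * w x ≤ C * ∫⁻ x, f x ^ p * maximal w x := by
  obtain ⟨C, hC⟩ : ∃ C : ℝ≥0, (C : ℝ≥0∞) = 2 ^ p * (ENNReal.ofReal p *
      (ENNReal.ofReal (5 ^ n) * (ENNReal.ofReal (p - 1))⁻¹ +
        0 * (ENNReal.ofReal (p + 1 - p))⁻¹)) := by
    refine ⟨_, ENNReal.coe_toNNReal ?_⟩
    rw [zero_mul, add_zero]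
    have : (ENNReal.ofReal (p - 1))⁻¹ ≠ ∞ := by simpa using hp
    finiteness
  refine ⟨C, fun f w hf hw => ?_⟩
  have h := lintegral_rpow_le_of_weak_bounds (μ := volume.withDensity w)
    (ν := volume.withDensity (maximal w)) (measurable_maximal f) hf hp (lt_add_one p)
    (A := ENNReal.ofReal (5 ^ n)) (B := 0) fun T hT => ?_
  · rw [← hC, lintegral_withDensity_eq_lintegral_mul _ hw (by have := measurable_maximal f; fun_prop),
      lintegral_withDensity_eq_lintegral_mul _ (measurable_maximal w) (by fun_prop)] at h
    simpa only [Pi.mul_apply, mul_comm] using h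
  · have hm : Measurable ({x | T < f x}.indicator f) :=
      hf.indicator (measurableSet_lt (by fun_prop) (by fun_prop))
    rw [zero_mul, add_zero, lintegral_withDensity_eq_lintegral_mul _ (measurable_maximal w) hm]
    calc _ ≤ T * (volume.withDensity w) {x | T < maximal ({x | T < f x}.indicator f) x} := by
          exact mul_le_mul_right (measure_mono (setOf_two_mul_lt_maximal_subset hf T)) _
      _ ≤ _ := weighted_weak_type _ w T
      _ = _ := by simp only [Pi.mul_apply, mul_comm]

theorem strong_type (n : ℕ) {p : ℝ} (hp : 1 < p) :
    ∃ C : ℝ≥0, ∀ f : (Fin n → ℝ) → ℝ≥0∞, Measurable f →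
      ∫⁻ x, maximal f x ^ p ≤ C * ∫⁻ x, f x ^ p := by
  obtain ⟨C, hC⟩ := weighted_strong_type n hp
  refine ⟨C, fun f hf => ?_⟩
  have h := hC f (fun _ => 1) hf measurable_const
  simp only [mul_one] at h
  refine h.trans ?_
  gcongr with x
  exact (mul_le_mul_right (maximal_const_le 1 x) _).trans_eq (mul_one _)

/-! ### Vector-valued bounds for p = r and p > r. -/

theorem measurable_lqNorm_maximal (q : ℝ≥0∞) (f : ℤ → (Fin n → ℝ) → ℝ≥0∞) :
    Measurable fun x => lqNorm q fun j => maximal (f j) x :=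
  measurable_lqNorm fun j => measurable_maximal (f j)

/-- The r-th power of the l_r norm is a sum, so the scalar weighted inequality can be added up over
j. -/
theorem lqNorm_maximal_weighted (n : ℕ) {r : ℝ} (hr : 1 < r) :
    ∃ C : ℝ≥0, ∀ (f : ℤ → (Fin n → ℝ) → ℝ≥0∞) (w : (Fin n → ℝ) → ℝ≥0∞),
      (∀ j, Measurable (f j)) → Measurable w →
      ∫⁻ x, lqNorm (ENNReal.ofReal r) (fun j => maximal (f j) x) ^ r * w x ≤
        C * ∫⁻ x, lqNorm (ENNReal.ofReal r) (fun j => f j x) ^ r * maximal w x := by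
  obtain ⟨C, hC⟩ := weighted_strong_type n hr
  refine ⟨C, fun f w hf hw => ?_⟩
  have hr0 : 0 < r := by linarith
  simp only [lqNorm_ofReal_rpow hr0, ← ENNReal.tsum_mul_right]
  have h₁ : ∀ j, AEMeasurable (fun x => maximal (f j) x ^ r * w x) := fun j =>
    (((measurable_maximal (f j)).pow_const _).mul hw).aemeasurable
  have h₂ : ∀ j, AEMeasurable (fun x => f j x ^ r * maximal w x) := fun j =>
    (((hf j).pow_const _).mul (measurable_maximal w)).aemeasurable
  rw [lintegral_tsum h₁, lintegral_tsum h₂, ← ENNReal.tsum_mul_left]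
  exact ENNReal.tsum_le_tsum fun j => hC (f j) w (hf j) hw

theorem lqNorm_maximal_diagonal (n : ℕ) {r : ℝ} (hr : 1 < r) :
    ∃ C : ℝ≥0, ∀ f : ℤ → (Fin n → ℝ) → ℝ≥0∞, (∀ j, Measurable (f j)) →
      ∫⁻ x, lqNorm (ENNReal.ofReal r) (fun j => maximal (f j) x) ^ r ≤
        C * ∫⁻ x, lqNorm (ENNReal.ofReal r) (fun j => f j x) ^ r := by
  obtain ⟨C, hC⟩ := lqNorm_maximal_weighted n hr
  refine ⟨C, fun f hf => ?_⟩
  have h := hC f (fun _ => 1) hf measurable_const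
  simp only [mul_one] at h
  refine h.trans ?_
  gcongr with x
  exact (mul_le_mul_right (maximal_const_le 1 x) _).trans_eq (mul_one _)

/-- Absorption of a power of `X` into the left side; dividing by it requires `X` to be finite. -/
theorem le_rpow_mul_of_le_mul_rpow {X K G : ℝ≥0∞} {θ : ℝ} (h0 : 0 < θ) (hX : X ≠ ∞)
    (h : X ≤ K * G ^ θ * X ^ (1 - θ)) : X ≤ K ^ (1 / θ) * G := by
  rcases eq_or_ne X 0 with rfl | hX0
  · exact zero_le
  have e : X = X ^ θ * X ^ (1 - θ) := by
    rw [← ENNReal.rpow_add _ _ hX0 hX, add_sub_cancel, ENNReal.rpow_one]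
  nth_rw 1 [e] at h
  have h := (ENNReal.mul_le_mul_iff_left (by simp [ENNReal.rpow_eq_zero_iff, hX0, hX])
    (by simp [ENNReal.rpow_eq_top_iff, hX0, hX])).1 h
  calc X = (X ^ θ) ^ (1 / θ) := by
        rw [← ENNReal.rpow_mul, mul_one_div_cancel h0.ne', ENNReal.rpow_one]
    _ ≤ (K * G ^ θ) ^ (1 / θ) := by gcongr
    _ = K ^ (1 / θ) * G := by
        rw [ENNReal.mul_rpow_of_nonneg _ _ (by positivity), ← ENNReal.rpow_mul,
          mul_one_div_cancel h0.ne', ENNReal.rpow_one]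

/-- Let Y be a truncation of the vector maximal function S. Then ∫ Y^p ≤ ∫ S^r Y^{p-r}, and the
weighted inequality moves M onto Y^{p-r}. Hölder with exponents p/r and p/(p-r), and the scalar
bound on L^{p/(p-r)}, return a power 1 - r/p of ∫ Y^p, which is absorbed. -/
theorem lqNorm_maximal_of_gt (n : ℕ) {p r : ℝ} (hr : 1 < r) (hrp : r < p) :
    ∃ C : ℝ≥0, ∀ f : ℤ → (Fin n → ℝ) → ℝ≥0∞, (∀ j, Measurable (f j)) →
      ∫⁻ x, lqNorm (ENNReal.ofReal r) (fun j => maximal (f j) x) ^ p ≤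
        C * ∫⁻ x, lqNorm (ENNReal.ofReal r) (fun j => f j x) ^ p := by
  have hr0 : 0 < r := by linarith
  have hp0 : 0 < p := by linarith
  have hpr : 0 < p - r := by linarith
  have hconj : (p / r).HolderConjugate (p / (p - r)) := by
    rw [Real.holderConjugate_iff]
    refine ⟨(one_lt_div hr0).2 hrp, ?_⟩
    field_simp; ring
  obtain ⟨C₁, hC₁⟩ := lqNorm_maximal_weighted n hr
  obtain ⟨C₂, hC₂⟩ := strong_type n hconj.symm.lt
  set K : ℝ≥0 := C₁ * C₂ ^ (1 - r / p) with hK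
  have hrp1 : r / p < 1 := (div_lt_one hp0).2 hrp
  refine ⟨K ^ (1 / (r / p)), fun f hf => ?_⟩
  set S : (Fin n → ℝ) → ℝ≥0∞ := fun x => lqNorm (ENNReal.ofReal r) fun j => maximal (f j) x with hS
  set g : (Fin n → ℝ) → ℝ≥0∞ := fun x => lqNorm (ENNReal.ofReal r) fun j => f j x with hg
  have hSm : Measurable S := measurable_lqNorm_maximal _ f
  have hgm : Measurable g := measurable_lqNorm hf
  have hBm : ∀ N : ℕ, MeasurableSet (cube (0 : Fin n → ℝ) N) := fun N => measurableSet_cube _ _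
  -- Truncating in both height and support makes ∫ Y^p finite, as the absorption demands; monotone
  -- convergence removes the truncation.
  set Y : ℕ → (Fin n → ℝ) → ℝ≥0∞ := fun N =>
    (cube 0 N).indicator fun x => min (S x) N with hY
  have hYm : ∀ N, Measurable (Y N) := fun N => (hSm.min measurable_const).indicator (hBm N)
  have hYS : ∀ N x, Y N x ≤ S x := fun N x =>
    indicator_apply_le' (fun _ => min_le_left _ _) (fun _ => zero_le)
  have hYN : ∀ N x, Y N x ≤ (cube 0 N).indicator (fun _ => (N : ℝ≥0∞)) x := fun N x =>
    indicator_le_indicator (min_le_right _ _)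
  have hmono : Monotone fun N x => Y N x ^ p := by
    intro N M hNM x
    have hcast : (N : ℝ) ≤ M := by exact_mod_cast hNM
    refine ENNReal.rpow_le_rpow ?_ hp0.le
    refine (indicator_le_indicator_of_subset (cube_subset_cube 0 hcast) (fun _ => zero_le) x).trans
      (indicator_le_indicator ?_)
    gcongr
  have hbound : ∀ N, ∫⁻ x, Y N x ^ p ≤ (K ^ (1 / (r / p)) : ℝ≥0) * ∫⁻ x, g x ^ p := by
    intro N
    rw [ENNReal.coe_rpow_of_nonneg _ (by positivity)]
    refine le_rpow_mul_of_le_mul_rpow (by positivity) ?_ ?_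
    · refine ne_top_of_le_ne_top ?_ (lintegral_mono fun x => ENNReal.rpow_le_rpow (hYN N x) hp0.le)
      have : (fun x => (cube (0 : Fin n → ℝ) N).indicator (fun _ => (N : ℝ≥0∞)) x ^ p) =
          (cube (0 : Fin n → ℝ) N).indicator (fun _ => (N : ℝ≥0∞) ^ p) := by
        funext x
        by_cases hx : x ∈ cube (0 : Fin n → ℝ) N <;> simp [hx, hp0]
      rw [this, lintegral_indicator_const (hBm N), volume_cube _ (Nat.cast_nonneg N)]
      finiteness
    have hw : Measurable fun x => Y N x ^ (p - r) := (hYm N).pow_const _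
    calc ∫⁻ x, Y N x ^ p = ∫⁻ x, Y N x ^ r * Y N x ^ (p - r) := by
          refine lintegral_congr fun x => ?_
          rw [← ENNReal.rpow_add_of_nonneg _ _ hr0.le hpr.le, add_sub_cancel]
      _ ≤ ∫⁻ x, S x ^ r * Y N x ^ (p - r) := by gcongr with x; exact hYS N x
      _ ≤ C₁ * ∫⁻ x, g x ^ r * maximal (fun x => Y N x ^ (p - r)) x := hC₁ f _ hf hw
      _ ≤ C₁ * ((∫⁻ x, (g x ^ r) ^ (p / r)) ^ (1 / (p / r)) *
          (∫⁻ x, maximal (fun x => Y N x ^ (p - r)) x ^ (p / (p - r))) ^ (1 / (p / (p - r)))) := by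
          gcongr
          exact ENNReal.lintegral_mul_le_Lp_mul_Lq _ hconj (hgm.pow_const _).aemeasurable
            (measurable_maximal _).aemeasurable
      _ ≤ C₁ * ((∫⁻ x, (g x ^ r) ^ (p / r)) ^ (1 / (p / r)) *
          (C₂ * ∫⁻ x, (Y N x ^ (p - r)) ^ (p / (p - r))) ^ (1 / (p / (p - r)))) := by
          gcongr
          exact hC₂ _ hw
      _ = _ := by
          simp only [← ENNReal.rpow_mul, mul_div_cancel₀ _ hr0.ne', mul_div_cancel₀ _ hpr.ne']
          have e1 : 1 / (p / (p - r)) = 1 - r / p := by field_simp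
          have e2 : 1 / (p / r) = r / p := by field_simp
          rw [e1, e2, ENNReal.mul_rpow_of_nonneg _ _ (by linarith), hK, ENNReal.coe_mul,
            ENNReal.coe_rpow_of_nonneg _ (by linarith)]
          ring
  calc ∫⁻ x, S x ^ p ≤ ∫⁻ x, ⨆ N, Y N x ^ p := by
        refine lintegral_mono fun x => ?_
        have hlim : Tendsto (fun N : ℕ => min (S x) (N : ℝ≥0∞) ^ p) atTop (𝓝 (min (S x) ∞ ^ p)) :=
          (ENNReal.continuous_rpow_const.tendsto _).comp
            (tendsto_const_nhds.min ENNReal.tendsto_nat_nhds_top)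
        rw [min_eq_left le_top] at hlim
        refine le_of_tendsto hlim ?_
        obtain ⟨N₀, hN₀⟩ := exists_nat_ge (2 * dist x 0)
        filter_upwards [eventually_ge_atTop N₀] with N hN
        refine le_iSup_of_le N (le_of_eq ?_)
        have hN' : (N₀ : ℝ) ≤ N := by exact_mod_cast hN
        have hx : x ∈ cube (0 : Fin n → ℝ) N := by
          rw [cube, Metric.mem_closedBall]; linarith
        simp only [hY]
        rw [indicator_of_mem hx]
    _ = ⨆ N, ∫⁻ x, Y N x ^ p := lintegral_iSup (fun N => (hYm N).pow_const _) hmono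
    _ ≤ _ := iSup_le hbound

/-! ### Whitney averaging over an open set. -/

/-- The kernel spreading the unit mass at a point `z` of an open set `Ω` uniformly over the cube
centred at `z` whose side length is half the distance from `z` to the complement of `Ω`. -/
def whitneyKernel (Ω : Set (Fin n → ℝ)) (w : (Fin n → ℝ) × (Fin n → ℝ)) : ℝ≥0∞ :=
  {w : (Fin n → ℝ) × (Fin n → ℝ) | w.2 ∈ Ω ∧ dist w.1 w.2 ≤ Metric.infDist w.2 Ωᶜ / 4}.indicator
    (fun w => (ENNReal.ofReal ((Metric.infDist w.2 Ωᶜ / 2) ^ n))⁻¹) w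

/-- The redistribution of `f` over Whitney-size cubes inside `Ω`. -/
def whitneyAverage (Ω : Set (Fin n → ℝ)) (f : (Fin n → ℝ) → ℝ≥0∞) (y : Fin n → ℝ) : ℝ≥0∞ :=
  ∫⁻ z, whitneyKernel Ω (y, z) * f z

theorem whitneyKernel_of_mem {Ω : Set (Fin n → ℝ)} {y z : Fin n → ℝ}
    (h : z ∈ Ω ∧ dist y z ≤ Metric.infDist z Ωᶜ / 4) :
    whitneyKernel Ω (y, z) = (ENNReal.ofReal ((Metric.infDist z Ωᶜ / 2) ^ n))⁻¹ :=
  indicator_of_mem (a := (y, z)) h _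

theorem whitneyKernel_of_notMem {Ω : Set (Fin n → ℝ)} {y z : Fin n → ℝ}
    (h : ¬ (z ∈ Ω ∧ dist y z ≤ Metric.infDist z Ωᶜ / 4)) : whitneyKernel Ω (y, z) = 0 :=
  indicator_of_notMem (a := (y, z)) h _

theorem measurable_whitneyKernel {Ω : Set (Fin n → ℝ)} (hΩ : IsOpen Ω) :
    Measurable (whitneyKernel Ω) := by
  have hd : Measurable fun z : Fin n → ℝ => Metric.infDist z Ωᶜ :=
    (Metric.continuous_infDist_pt _).measurable
  refine Measurable.indicator ?_ ?_
  · have : Measurable fun w : (Fin n → ℝ) × (Fin n → ℝ) => Metric.infDist w.2 Ωᶜ :=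
      hd.comp measurable_snd
    fun_prop
  · exact (measurable_snd hΩ.measurableSet).inter (measurableSet_le
      (f := fun w : (Fin n → ℝ) × (Fin n → ℝ) => dist w.1 w.2) (by fun_prop)
      ((hd.comp measurable_snd).div_const 4))

theorem measurable_whitneyAverage {Ω : Set (Fin n → ℝ)} (hΩ : IsOpen Ω)
    {f : (Fin n → ℝ) → ℝ≥0∞} (hf : Measurable f) : Measurable (whitneyAverage Ω f) := by
  have h := measurable_whitneyKernel hΩ
  exact Measurable.lintegral_prod_right' (f := fun w : (Fin n → ℝ) × (Fin n → ℝ) =>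
    whitneyKernel Ω w * f w.2) (by fun_prop)

theorem infDist_compl_pos {Ω : Set (Fin n → ℝ)} (hΩ : IsOpen Ω) (hne : Ωᶜ.Nonempty)
    {z : Fin n → ℝ} (hz : z ∈ Ω) : 0 < Metric.infDist z Ωᶜ :=
  (hΩ.isClosed_compl.notMem_iff_infDist_pos hne).1 fun h => h hz

theorem lintegral_whitneyKernel {Ω : Set (Fin n → ℝ)} (hΩ : IsOpen Ω) (hne : Ωᶜ.Nonempty)
    {z : Fin n → ℝ} (hz : z ∈ Ω) {s : Set (Fin n → ℝ)}
    (hs : cube z (Metric.infDist z Ωᶜ / 2) ⊆ s) : 1 ≤ ∫⁻ y in s, whitneyKernel Ω (y, z) := by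
  have hd := infDist_compl_pos hΩ hne hz
  set d := Metric.infDist z Ωᶜ with hdd
  calc 1 = ∫⁻ y in cube z (d / 2), (ENNReal.ofReal ((d / 2) ^ n))⁻¹ := by
        rw [setLIntegral_const, ← volume_cube z (by positivity),
          ENNReal.inv_mul_cancel (volume_cube_ne_zero z (by positivity))
            (volume_cube_ne_top z (by positivity))]
    _ = ∫⁻ y in cube z (d / 2), whitneyKernel Ω (y, z) := by
        refine setLIntegral_congr_fun (measurableSet_cube _ _) fun y hy => ?_
        have hy : dist y z ≤ d / 2 / 2 := hy
        rw [whitneyKernel_of_mem ⟨hz, by linarith⟩]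
    _ ≤ _ := lintegral_mono_set hs

/-- If a cube of side l contains x ∉ Ω, each of its points z ∈ Ω is within l of the complement of Ω.
The mass at z is spread no farther than l/4 and stays inside the doubled cube, so the average loses
only the factor 2^n. -/
theorem maximal_indicator_le_whitneyAverage {Ω : Set (Fin n → ℝ)} (hΩ : IsOpen Ω)
    {f : (Fin n → ℝ) → ℝ≥0∞} (hf : Measurable f) {x : Fin n → ℝ} (hx : x ∉ Ω) :
    maximal (Ω.indicator f) x ≤ 2 ^ n * maximal (whitneyAverage Ω f) x := by
  have hne : Ωᶜ.Nonempty := ⟨x, hx⟩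
  have hK := measurable_whitneyKernel hΩ
  refine maximal_le_iff.2 fun c l hl hxc => ?_
  have h2 : 0 < 2 * l := by positivity
  have hxc' : dist x c ≤ l / 2 := hxc
  calc ∫⁻ z in cube c l, Ω.indicator f z
      ≤ ∫⁻ z in cube c l, ∫⁻ y in cube c (2 * l), whitneyKernel Ω (y, z) * f z := by
        refine setLIntegral_mono' (measurableSet_cube _ _) fun z hz => ?_
        have hz' : dist z c ≤ l / 2 := hz
        by_cases hzΩ : z ∈ Ω
        · rw [indicator_of_mem hzΩ, lintegral_mul_const _ (by fun_prop)]
          refine le_mul_of_one_le_left' (lintegral_whitneyKernel hΩ hne hzΩ ?_)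
          refine Metric.closedBall_subset_closedBall' ?_
          have h1 : Metric.infDist z Ωᶜ ≤ dist z x := Metric.infDist_le_dist_of_mem hx
          have h3 := dist_triangle_right z x c
          linarith
        · rw [indicator_of_notMem hzΩ]; exact zero_le
    _ = ∫⁻ y in cube c (2 * l), ∫⁻ z in cube c l, whitneyKernel Ω (y, z) * f z :=
        lintegral_lintegral_swap (f := fun z y => whitneyKernel Ω (y, z) * f z)
          (Measurable.aemeasurable (by fun_prop))
    _ ≤ ∫⁻ y in cube c (2 * l), whitneyAverage Ω f y :=
        lintegral_mono fun y => setLIntegral_le_lintegral _ _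
    _ ≤ volume (cube c (2 * l)) * maximal (whitneyAverage Ω f) x :=
        lintegral_cube_le_maximal _ h2 (cube_subset_cube c (by linarith) hxc)
    _ = _ := by
        rw [volume_cube c h2.le, volume_cube c hl.le, mul_pow, ENNReal.ofReal_mul (by positivity),
          ENNReal.ofReal_pow (by positivity), ENNReal.ofReal_ofNat]
        ring

/-- Points z sending mass to y have distance to the complement of Ω comparable to that of y, d(y).
They lie in a cube about y of side 4d(y), which also contains a point outside Ω, where averages are
at most `T`. The kernel is at most (2d(y)/5)^{-n}, and 4/(2/5) = 10. -/
theorem whitneyAverage_le {Ω : Set (Fin n → ℝ)} (hΩ : IsOpen Ω) (hne : Ωᶜ.Nonempty)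
    {g : (Fin n → ℝ) → ℝ≥0∞} {T : ℝ≥0∞} (hT : ∀ x ∉ Ω, maximal g x ≤ T) (y : Fin n → ℝ) :
    whitneyAverage Ω g y ≤ Ω.indicator (fun _ => 10 ^ n * T) y := by
  set d : (Fin n → ℝ) → ℝ := fun z => Metric.infDist z Ωᶜ with hd
  have hlip : ∀ y z, d y ≤ d z + dist y z := fun y z => Metric.infDist_le_infDist_add_dist
  have hsupp : ∀ z, z ∈ Ω → dist y z ≤ d z / 4 → 3 / 4 * d z ≤ d y ∧ d y ≤ 5 / 4 * d z := by
    intro z hz hyz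
    have h1 := hlip z y
    have h2 := hlip y z
    rw [dist_comm] at h1
    constructor <;> linarith
  by_cases hy : y ∈ Ω
  · rw [indicator_of_mem hy]
    have hdy : 0 < d y := infDist_compl_pos hΩ hne hy
    obtain ⟨x, hxΩ, hx⟩ := (Metric.infDist_lt_iff hne).1 (show d y < 2 * d y by linarith)
    have h4 : 0 < 4 * d y := by positivity
    calc whitneyAverage Ω g y
        ≤ ∫⁻ z, (cube y (4 * d y)).indicator
            (fun z => (ENNReal.ofReal ((2 / 5 * d y) ^ n))⁻¹ * g z) z := by
          refine lintegral_mono fun z => ?_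
          by_cases hz : z ∈ Ω ∧ dist y z ≤ d z / 4
          · obtain ⟨h1, h2⟩ := hsupp z hz.1 hz.2
            have hzc : z ∈ cube y (4 * d y) := by
              rw [cube, Metric.mem_closedBall, dist_comm]
              linarith [hz.2]
            rw [whitneyKernel_of_mem hz, indicator_of_mem hzc]
            gcongr
            change 2 / 5 * d y ≤ d z / 2
            linarith
          · rw [whitneyKernel_of_notMem hz, zero_mul]; exact zero_le
      _ = ∫⁻ z in cube y (4 * d y), (ENNReal.ofReal ((2 / 5 * d y) ^ n))⁻¹ * g z :=
          lintegral_indicator (measurableSet_cube _ _) _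
      _ = (ENNReal.ofReal ((2 / 5 * d y) ^ n))⁻¹ * ∫⁻ z in cube y (4 * d y), g z := by
          refine lintegral_const_mul' _ _ (ENNReal.inv_ne_top.2 ?_)
          simp only [ne_eq, ENNReal.ofReal_eq_zero, not_le]; positivity
      _ ≤ (ENNReal.ofReal ((2 / 5 * d y) ^ n))⁻¹ * (volume (cube y (4 * d y)) * T) := by
          gcongr
          refine (lintegral_cube_le_maximal g h4 (x := x) ?_).trans (by gcongr; exact hT x hxΩ)
          rw [cube, Metric.mem_closedBall, dist_comm]
          linarith
      _ = 10 ^ n * T := by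
          have hpos : 0 < (2 / 5 * d y) ^ n := by positivity
          rw [volume_cube _ h4.le, ← mul_assoc, ← ENNReal.ofReal_inv_of_pos hpos,
            ← ENNReal.ofReal_mul (by positivity)]
          congr 1
          have : ((2 / 5 * d y) ^ n)⁻¹ * (4 * d y) ^ n = 10 ^ n := by
            rw [← inv_pow, ← mul_pow]
            congr 1; field_simp; norm_num
          rw [this, ENNReal.ofReal_pow (by norm_num), ENNReal.ofReal_ofNat]
  · rw [indicator_of_notMem hy]
    refine le_of_eq (lintegral_eq_zero_of_ae_eq_zero (ae_of_all _ fun z => ?_))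
    have hz : ¬ (z ∈ Ω ∧ dist y z ≤ d z / 4) := by
      rintro ⟨h1, h2⟩
      have h3 := (hsupp z h1 h2).1
      have h4 : d y = 0 := Metric.infDist_zero_of_mem hy
      have h5 : 0 < d z := infDist_compl_pos hΩ hne h1
      linarith
    simp only [whitneyKernel_of_notMem hz, zero_mul, Pi.zero_apply]

theorem lqNorm_whitneyAverage_le {q : ℝ≥0∞} (hq : 1 < q) {Ω : Set (Fin n → ℝ)} (hΩ : IsOpen Ω)
    {f : ℤ → (Fin n → ℝ) → ℝ≥0∞} (hf : ∀ j, Measurable (f j)) (y : Fin n → ℝ) :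
    lqNorm q (fun j => whitneyAverage Ω (f j) y) ≤
      whitneyAverage Ω (fun z => lqNorm q fun j => f j z) y := by
  have hK := measurable_whitneyKernel hΩ
  refine (lqNorm_lintegral_le hq fun j => ?_).trans_eq ?_
  · have := hf j
    fun_prop
  · simp only [lqNorm_const_mul hq]
    rfl

theorem lqNorm_indicator {q : ℝ≥0∞} (hq : 1 < q) (s : Set (Fin n → ℝ))
    (f : ℤ → (Fin n → ℝ) → ℝ≥0∞) (x : Fin n → ℝ) :
    lqNorm q (fun j => s.indicator (f j) x) = s.indicator (fun x => lqNorm q fun j => f j x) x := by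
  by_cases hx : x ∈ s
  · simp [hx]
  · have h := lqNorm_const_mul hq 0 fun j => f j x
    simp only [zero_mul] at h
    simpa [hx] using h

theorem lqNorm_maximal_add_le {q : ℝ≥0∞} (hq : 1 < q) {f g : ℤ → (Fin n → ℝ) → ℝ≥0∞}
    (hf : ∀ j, Measurable (f j)) (x : Fin n → ℝ) :
    lqNorm q (fun j => maximal (fun y => f j y + g j y) x) ≤
      lqNorm q (fun j => maximal (f j) x) + lqNorm q (fun j => maximal (g j) x) :=
  (lqNorm_mono fun j => maximal_add_le (hf j) (g j) x).trans (lqNorm_add_le hq _ _)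

theorem lqNorm_maximal_split {q : ℝ≥0∞} (hq : 1 < q) {f : ℤ → (Fin n → ℝ) → ℝ≥0∞}
    (hf : ∀ j, Measurable (f j)) {s : Set (Fin n → ℝ)} (hs : MeasurableSet s) (x : Fin n → ℝ) :
    lqNorm q (fun j => maximal (f j) x) ≤
      lqNorm q (fun j => maximal (s.indicator (f j)) x) +
        lqNorm q (fun j => maximal (sᶜ.indicator (f j)) x) := by
  refine le_trans (le_of_eq ?_) (lqNorm_maximal_add_le hq (fun j => (hf j).indicator hs) x)
  simp only [indicator_self_add_compl_apply]

/-! ### The vector-valued weak type (1,1) bound. -/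

theorem mul_meas_le_lintegral_rpow {S : (Fin n → ℝ) → ℝ≥0∞} (hS : Measurable S) {p : ℝ}
    (hp : 0 < p) (T : ℝ≥0∞) :
    T ^ p * volume {x | T < S x} ≤ ∫⁻ x, S x ^ p := by
  refine le_trans ?_ (mul_meas_ge_le_lintegral (hS.pow_const p) (T ^ p))
  gcongr with x
  intro h
  exact ENNReal.rpow_le_rpow h.le hp.le

/-- The Fefferman–Stein weak type `(1, 1)` inequality, for finite `q`. -/
theorem lqNorm_maximal_weak (n : ℕ) {r : ℝ} (hr : 1 < r) :
    ∃ C : ℝ≥0, ∀ f : ℤ → (Fin n → ℝ) → ℝ≥0∞, (∀ j, Measurable (f j)) → ∀ T : ℝ≥0,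
      T * volume {x | T < lqNorm (ENNReal.ofReal r) fun j => maximal (f j) x} ≤
        C * ∫⁻ x, lqNorm (ENNReal.ofReal r) fun j => f j x := by
  have hr0 : 0 < r := by linarith
  have hq : 1 < ENNReal.ofReal r := by simpa using hr
  obtain ⟨C, hC⟩ := lqNorm_maximal_diagonal n hr
  set D : ℝ≥0 := (2 ^ n) ^ r * (C * (10 ^ n) ^ r) with hD
  suffices h : ∀ f : ℤ → (Fin n → ℝ) → ℝ≥0∞, (∀ j, Measurable (f j)) → ∀ T : ℝ≥0, 0 < T →
      T * volume {x | 2 * T < lqNorm (ENNReal.ofReal r) fun j => maximal (f j) x} ≤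
        (5 ^ n + C + D * 5 ^ n + 1 : ℝ≥0) * ∫⁻ x, lqNorm (ENNReal.ofReal r) fun j => f j x by
    refine ⟨2 * (5 ^ n + C + D * 5 ^ n + 1), fun f hf T => ?_⟩
    rcases eq_or_ne T 0 with rfl | hT
    · simp
    have h' := h f hf (T / 2) (by positivity)
    have e : 2 * ((T / 2 : ℝ≥0) : ℝ≥0∞) = T := by
      rw [← ENNReal.coe_ofNat, ← ENNReal.coe_mul, mul_div_cancel₀ _ two_ne_zero]
    rw [e] at h'
    calc _ = 2 * ((T / 2 : ℝ≥0) * volume {x | (T : ℝ≥0∞) <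
          lqNorm (ENNReal.ofReal r) fun j => maximal (f j) x}) := by
            rw [← mul_assoc, e]
      _ ≤ 2 * ((5 ^ n + C + D * 5 ^ n + 1 : ℝ≥0) *
          ∫⁻ x, lqNorm (ENNReal.ofReal r) fun j => f j x) := mul_le_mul_right h' 2
      _ = _ := by rw [← mul_assoc, ENNReal.coe_mul 2, ENNReal.coe_ofNat]
  intro f hf T hT
  set g : (Fin n → ℝ) → ℝ≥0∞ := fun x => lqNorm (ENNReal.ofReal r) fun j => f j x with hg
  have hgm : Measurable g := measurable_lqNorm hf
  -- Lebesgue differentiation below needs g integrable.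
  rcases eq_or_ne (∫⁻ x, g x) ∞ with hinf | hfin
  · rw [hinf, ENNReal.mul_top (by positivity)]; exact le_top
  have hT0 : (T : ℝ≥0∞) ≠ 0 := by exact_mod_cast hT.ne'
  have hTr : (T : ℝ≥0∞) ^ r = T ^ (r - 1) * T := by
    nth_rw 3 [← ENNReal.rpow_one (T : ℝ≥0∞)]
    rw [← ENNReal.rpow_add_of_nonneg _ _ (by linarith) zero_le_one, sub_add_cancel]
  have hTr0 : (T : ℝ≥0∞) ^ (r - 1) ≠ 0 := by simp [ENNReal.rpow_eq_zero_iff, hT0]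
  have hTrtop : (T : ℝ≥0∞) ^ (r - 1) ≠ ∞ := by simp [ENNReal.rpow_eq_top_iff, hT0]
  set Ω : Set (Fin n → ℝ) := {x | T < maximal g x} with hΩdef
  have hΩ : IsOpen Ω := isOpen_lt_maximal g T
  have hΩT : ∀ x ∉ Ω, maximal g x ≤ T := fun x hx => not_lt.1 hx
  have hΩvol : T * volume Ω ≤ 5 ^ n * ∫⁻ x, g x := by
    simpa [ENNReal.ofReal_pow] using weak_type g T
  -- Off Ω one has g ≤ Mg ≤ T almost everywhere, so g^r ≤ T^{r-1} g there and the case p = r gives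
  -- the bound.
  have hgood : T * volume {x | T < lqNorm (ENNReal.ofReal r)
      fun j => maximal (Ωᶜ.indicator (f j)) x} ≤ C * ∫⁻ x, g x := by
    rw [← ENNReal.mul_le_mul_iff_right hTr0 hTrtop, ← mul_assoc, ← hTr]
    calc _ ≤ ∫⁻ x, lqNorm (ENNReal.ofReal r) (fun j => maximal (Ωᶜ.indicator (f j)) x) ^ r :=
          mul_meas_le_lintegral_rpow (measurable_lqNorm_maximal _ _) hr0 _
      _ ≤ C * ∫⁻ x, lqNorm (ENNReal.ofReal r) (fun j => Ωᶜ.indicator (f j) x) ^ r :=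
          hC _ fun j => (hf j).indicator hΩ.measurableSet.compl
      _ ≤ C * ∫⁻ x, T ^ (r - 1) * g x := by
          gcongr C * ?_
          refine lintegral_mono_ae ?_
          filter_upwards [ae_le_maximal hgm hfin] with x hx
          rw [lqNorm_indicator hq]
          by_cases hxΩ : x ∈ Ωᶜ
          · rw [indicator_of_mem hxΩ]
            have hgT : g x ≤ T := hx.trans (hΩT x hxΩ)
            calc g x ^ r = g x ^ (r - 1) * g x := by
                  nth_rw 3 [← ENNReal.rpow_one (g x)]
                  rw [← ENNReal.rpow_add_of_nonneg _ _ (by linarith) zero_le_one, sub_add_cancel]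
              _ ≤ _ := by gcongr
          · rw [indicator_of_notMem hxΩ, ENNReal.zero_rpow_of_pos hr0]; exact zero_le
      _ = _ := by rw [lintegral_const_mul _ hgm]; ring
  -- Off Ω the bad part may be replaced by its Whitney average, whose l_r norm is at most 10^n T and
  -- vanishes outside Ω. The case p = r then gives a multiple of T|Ω|, which the scalar weak bound
  -- controls.
  have hbad : T * volume (Ωᶜ ∩ {x | T < lqNorm (ENNReal.ofReal r)
      fun j => maximal (Ω.indicator (f j)) x}) ≤ D * 5 ^ n * ∫⁻ x, g x := by
    rcases (Ωᶜ).eq_empty_or_nonempty with hemp | hne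
    · simp [hemp]
    have hFm : ∀ j, Measurable (whitneyAverage Ω (f j)) := fun j =>
      measurable_whitneyAverage hΩ (hf j)
    set S : (Fin n → ℝ) → ℝ≥0∞ := fun x => lqNorm (ENNReal.ofReal r)
      fun j => maximal (whitneyAverage Ω (f j)) x with hS
    have hSm : Measurable S := measurable_lqNorm_maximal _ _
    have hkey : T * volume (Ωᶜ ∩ {x | T < lqNorm (ENNReal.ofReal r)
        fun j => maximal (Ω.indicator (f j)) x}) ≤ D * (T * volume Ω) := by
      rw [← ENNReal.mul_le_mul_iff_right hTr0 hTrtop, ← mul_assoc, ← hTr]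
      calc _ ≤ T ^ r * volume {x | T < 2 ^ n * S x} := by
            gcongr
            rintro x ⟨hx, hTx⟩
            have hTx : (T : ℝ≥0∞) < lqNorm (ENNReal.ofReal r)
              fun j => maximal (Ω.indicator (f j)) x := hTx
            refine lt_of_lt_of_le hTx ?_
            rw [← lqNorm_const_mul hq]
            exact lqNorm_mono fun j => maximal_indicator_le_whitneyAverage hΩ (hf j) hx
        _ ≤ ∫⁻ x, (2 ^ n * S x) ^ r :=
            mul_meas_le_lintegral_rpow (by fun_prop) hr0 _
        _ = (2 ^ n) ^ r * ∫⁻ x, S x ^ r := by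
            simp only [ENNReal.mul_rpow_of_nonneg _ _ hr0.le]
            exact lintegral_const_mul _ (by fun_prop)
        _ ≤ (2 ^ n) ^ r * (C * ∫⁻ x, lqNorm (ENNReal.ofReal r)
              (fun j => whitneyAverage Ω (f j) x) ^ r) := by
            gcongr
            exact hC _ hFm
        _ ≤ (2 ^ n) ^ r * (C * ∫⁻ x, Ω.indicator (fun _ => (10 ^ n) ^ r * T ^ r) x) := by
            gcongr with x
            refine (ENNReal.rpow_le_rpow ((lqNorm_whitneyAverage_le hq hΩ hf x).trans
              (whitneyAverage_le hΩ hne hΩT x)) hr0.le).trans ?_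
            by_cases hx : x ∈ Ω
            · rw [indicator_of_mem hx, indicator_of_mem hx, ENNReal.mul_rpow_of_nonneg _ _ hr0.le]
            · rw [indicator_of_notMem hx, ENNReal.zero_rpow_of_pos hr0]; exact zero_le
        _ = _ := by
            rw [lintegral_indicator_const hΩ.measurableSet, hTr, hD]
            push_cast [ENNReal.coe_rpow_of_nonneg _ hr0.le]
            ring
    calc _ ≤ D * (T * volume Ω) := hkey
      _ ≤ D * (5 ^ n * ∫⁻ x, g x) := by gcongr
      _ = _ := by ring
  have hcover : {x | 2 * T < lqNorm (ENNReal.ofReal r) fun j => maximal (f j) x} ⊆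
      Ω ∪ {x | T < lqNorm (ENNReal.ofReal r) fun j => maximal (Ωᶜ.indicator (f j)) x} ∪
      (Ωᶜ ∩ {x | T < lqNorm (ENNReal.ofReal r) fun j => maximal (Ω.indicator (f j)) x}) := by
    intro x hx
    by_contra hcon
    simp only [mem_union, mem_inter_iff, mem_ofPred_eq, not_or, not_and, not_lt] at hcon
    obtain ⟨⟨h1, h2⟩, h3⟩ := hcon
    have hx : 2 * T < lqNorm (ENNReal.ofReal r) fun j => maximal (f j) x := hx
    refine hx.not_ge ?_
    rw [two_mul]
    exact (lqNorm_maximal_split hq hf hΩ.measurableSet x).trans (add_le_add (h3 h1) h2)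
  calc _ ≤ T * (volume Ω + volume {x | T < lqNorm (ENNReal.ofReal r)
          fun j => maximal (Ωᶜ.indicator (f j)) x} +
        volume (Ωᶜ ∩ {x | T < lqNorm (ENNReal.ofReal r)
          fun j => maximal (Ω.indicator (f j)) x})) := by
        gcongr
        refine (measure_mono hcover).trans ((measure_union_le _ _).trans ?_)
        gcongr
        exact measure_union_le _ _
    _ ≤ 5 ^ n * (∫⁻ x, g x) + C * (∫⁻ x, g x) + D * 5 ^ n * ∫⁻ x, g x := by
        rw [mul_add, mul_add]
        gcongr
    _ = (5 ^ n + C + D * 5 ^ n) * ∫⁻ x, g x := by ring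
    _ ≤ _ := by
        gcongr
        push_cast
        exact le_self_add

/-! ### The case p < r and the Fefferman–Stein inequalities. -/

/-- Interpolation between weak type (1,1) and the case p = r: the whole sequence is cut according to
whether its l_r norm exceeds T. -/
theorem lqNorm_maximal_of_lt (n : ℕ) {p r : ℝ} (hp : 1 < p) (hpr : p < r) :
    ∃ C : ℝ≥0, ∀ f : ℤ → (Fin n → ℝ) → ℝ≥0∞, (∀ j, Measurable (f j)) →
      ∫⁻ x, lqNorm (ENNReal.ofReal r) (fun j => maximal (f j) x) ^ p ≤
        C * ∫⁻ x, lqNorm (ENNReal.ofReal r) (fun j => f j x) ^ p := by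
  have hr : 1 < r := hp.trans hpr
  have hr0 : 0 < r := by linarith
  have hq : 1 < ENNReal.ofReal r := by simpa using hr
  obtain ⟨A, hA⟩ := lqNorm_maximal_weak n hr
  obtain ⟨B, hB⟩ := lqNorm_maximal_diagonal n hr
  obtain ⟨C, hC⟩ : ∃ C : ℝ≥0, (C : ℝ≥0∞) = 2 ^ p * (ENNReal.ofReal p *
      (A * (ENNReal.ofReal (p - 1))⁻¹ + B * (ENNReal.ofReal (r - p))⁻¹)) := by
    refine ⟨_, ENNReal.coe_toNNReal ?_⟩
    have h1 : (ENNReal.ofReal (p - 1))⁻¹ ≠ ∞ := by simpa using hp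
    have h2 : (ENNReal.ofReal (r - p))⁻¹ ≠ ∞ := by simpa using hpr
    finiteness
  refine ⟨C, fun f hf => ?_⟩
  rw [hC]
  set g : (Fin n → ℝ) → ℝ≥0∞ := fun x => lqNorm (ENNReal.ofReal r) fun j => f j x with hg
  have hgm : Measurable g := measurable_lqNorm hf
  refine lintegral_rpow_le_of_weak_bounds (measurable_lqNorm_maximal _ f) hgm hp hpr
    fun T hT => ?_
  set s : Set (Fin n → ℝ) := {x | T < g x} with hs
  have hsm : MeasurableSet s := measurableSet_lt (by fun_prop) (by fun_prop)
  have hsc : sᶜ = {x | g x ≤ T} := by ext x; simp [hs]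
  have hT0 : (T : ℝ≥0∞) ≠ 0 := by exact_mod_cast hT.ne'
  have h1 : T * volume {x | T < lqNorm (ENNReal.ofReal r)
      fun j => maximal (s.indicator (f j)) x} ≤ A * ∫⁻ x, s.indicator g x := by
    refine (hA _ (fun j => (hf j).indicator hsm) T).trans_eq ?_
    simp only [lqNorm_indicator hq, hg]
  have h2 : T * volume {x | T < lqNorm (ENNReal.ofReal r)
      fun j => maximal (sᶜ.indicator (f j)) x} ≤
      B * ((T : ℝ≥0∞) ^ (1 - r) * ∫⁻ x, sᶜ.indicator (fun x => g x ^ r) x) := by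
    have e : (T : ℝ≥0∞) = T ^ (1 - r) * T ^ r := by
      rw [← ENNReal.rpow_add _ _ hT0 ENNReal.coe_ne_top, sub_add_cancel, ENNReal.rpow_one]
    calc _ = (T : ℝ≥0∞) ^ (1 - r) * (T ^ r * volume {x | T < lqNorm (ENNReal.ofReal r)
          fun j => maximal (sᶜ.indicator (f j)) x}) := by
          rw [← mul_assoc, ← e]
      _ ≤ (T : ℝ≥0∞) ^ (1 - r) * (B * ∫⁻ x, lqNorm (ENNReal.ofReal r)
          (fun j => sᶜ.indicator (f j) x) ^ r) := by
          refine mul_le_mul_right ((mul_meas_le_lintegral_rpow (measurable_lqNorm_maximal _ _)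
            hr0 _).trans (hB _ fun j => (hf j).indicator hsm.compl)) _
      _ = _ := by
          have : ∀ x, lqNorm (ENNReal.ofReal r) (fun j => sᶜ.indicator (f j) x) ^ r =
              sᶜ.indicator (fun x => g x ^ r) x := by
            intro x
            rw [lqNorm_indicator hq]
            by_cases hx : x ∈ sᶜ
            · rw [indicator_of_mem hx, indicator_of_mem hx]
            · rw [indicator_of_notMem hx, indicator_of_notMem hx, ENNReal.zero_rpow_of_pos hr0]
          simp only [this]
          ring
  rw [← hsc]
  refine le_trans ?_ (add_le_add h1 h2)
  rw [← mul_add]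
  refine mul_le_mul_right ((measure_mono ?_).trans (measure_union_le _ _)) _
  intro x hx
  by_contra hcon
  simp only [mem_union, mem_ofPred_eq, not_or, not_lt] at hcon
  have hx : 2 * T < lqNorm (ENNReal.ofReal r) fun j => maximal (f j) x := hx
  refine hx.not_ge ?_
  rw [two_mul]
  exact (lqNorm_maximal_split hq hf hsm x).trans (add_le_add hcon.1 hcon.2)

theorem lqNorm_top_maximal_le (f : ℤ → (Fin n → ℝ) → ℝ≥0∞) (x : Fin n → ℝ) :
    lqNorm ∞ (fun j => maximal (f j) x) ≤ maximal (fun y => lqNorm ∞ fun j => f j y) x := by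
  rw [lqNorm_top]
  refine iSup_le fun j => maximal_mono (fun y => ?_) x
  rw [lqNorm_top]
  exact le_iSup (fun j => f j y) j

/-- The Fefferman–Stein vector-valued maximal inequality. -/
theorem fefferman_stein_strong (n : ℕ) {p : ℝ} (hp : 1 < p) {q : ℝ≥0∞} (hq : 1 < q) :
    ∃ C : ℝ≥0, ∀ f : ℤ → (Fin n → ℝ) → ℝ≥0∞, (∀ j, Measurable (f j)) →
      ∫⁻ x, lqNorm q (fun j => maximal (f j) x) ^ p ≤ C * ∫⁻ x, lqNorm q (fun j => f j x) ^ p := by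
  rcases eq_top_or_exists_ofReal hq with rfl | ⟨r, hr, rfl⟩
  · obtain ⟨C, hC⟩ := strong_type n hp
    refine ⟨C, fun f hf => le_trans ?_ (hC _ (measurable_lqNorm hf))⟩
    exact lintegral_mono fun x => ENNReal.rpow_le_rpow (lqNorm_top_maximal_le f x) (by linarith)
  · rcases lt_trichotomy p r with h | rfl | h
    · exact lqNorm_maximal_of_lt n hp h
    · exact lqNorm_maximal_diagonal n hr
    · exact lqNorm_maximal_of_gt n hr h

theorem fefferman_stein_weak (n : ℕ) {p : ℝ} (hp : 1 ≤ p) {q : ℝ≥0∞} (hq : 1 < q) :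
    ∃ C : ℝ≥0, ∀ f : ℤ → (Fin n → ℝ) → ℝ≥0∞, (∀ j, Measurable (f j)) → ∀ T : ℝ≥0,
      (T : ℝ≥0∞) ^ p * volume {x | T < lqNorm q fun j => maximal (f j) x} ≤
        C * ∫⁻ x, lqNorm q (fun j => f j x) ^ p := by
  rcases hp.eq_or_lt with rfl | hp
  · simp only [ENNReal.rpow_one]
    rcases eq_top_or_exists_ofReal hq with rfl | ⟨r, hr, rfl⟩
    · refine ⟨5 ^ n, fun f hf T => ?_⟩
      calc _ ≤ T * volume {x | T < maximal (fun y => lqNorm ∞ fun j => f j y) x} :=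
            mul_le_mul_right (measure_mono fun x hx =>
              lt_of_lt_of_le (show (T : ℝ≥0∞) < _ from hx) (lqNorm_top_maximal_le f x)) _
        _ ≤ _ := weak_type _ T
        _ = _ := by simp [ENNReal.ofReal_pow]
    · exact lqNorm_maximal_weak n hr
  · obtain ⟨C, hC⟩ := fefferman_stein_strong n hp hq
    exact ⟨C, fun f hf T => (mul_meas_le_lintegral_rpow (measurable_lqNorm_maximal _ _)
      (by linarith) _).trans (hC f hf)⟩

/-! ### Local estimates on a cube by the tail integral. -/

/-- The Hardy-type integral which controls the maximal function on the cube `cube c l`. -/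
def tailIntegral (p : ℝ) (g : (Fin n → ℝ) → ℝ≥0∞) (c : Fin n → ℝ) (l : ℝ) : ℝ≥0∞ :=
  ∫⁻ t in Ioi l, (∫⁻ y in cube c t, g y ^ p) ^ (1 / p) * ENNReal.ofReal (t ^ (-((n : ℝ) / p) - 1))

theorem monotone_lintegral_cube (g : (Fin n → ℝ) → ℝ≥0∞) (c : Fin n → ℝ) :
    Monotone fun t => ∫⁻ y in cube c t, g y :=
  fun _ _ h => lintegral_mono_set (cube_subset_cube c h)

theorem ofReal_rpow_cube {l : ℝ} (hl : 0 < l) (p : ℝ) (c : Fin n → ℝ) :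
    (volume (cube c l))⁻¹ ^ (1 / p) = ENNReal.ofReal (l ^ (-((n : ℝ) / p))) := by
  rw [volume_cube c hl.le, ← ENNReal.ofReal_inv_of_pos (by positivity),
    ENNReal.ofReal_rpow_of_pos (by positivity)]
  congr 1
  rw [← Real.rpow_natCast, ← Real.rpow_neg hl.le, ← Real.rpow_mul hl.le]
  congr 1; ring

/-- For every s > t, the L^p norm over `cube c t` is at most that over `cube c s`, hence at most
φ₁(c,s) s^{n/p} times the Morrey norm. Taking the infimum over s produces exactly the integrand of
the hypothesis. -/
theorem tailIntegral_le_morreyNorm {p : ℝ} (hp : 1 ≤ p) {φ₁ φ₂ : (Fin n → ℝ) → ℝ → ℝ}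
    (hφ₁ : ∀ x t, 0 < t → 0 < φ₁ x t) {K : ℝ≥0}
    (hK : ∀ (x : Fin n → ℝ) (t : ℝ), 0 < t →
      ∫⁻ τ in Ioi t, (⨅ (s : ℝ) (_ : τ < s), ENNReal.ofReal (φ₁ x s * s ^ ((n : ℝ) / p))) *
        ENNReal.ofReal (τ ^ (-((n : ℝ) / p) - 1)) ≤ K * ENNReal.ofReal (φ₂ x t))
    {g : (Fin n → ℝ) → ℝ≥0∞} (hg : morreyNorm p φ₁ g ≠ ∞) (c : Fin n → ℝ) {l : ℝ} (hl : 0 < l) :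
    tailIntegral p g c l ≤ morreyNorm p φ₁ g * (K * ENNReal.ofReal (φ₂ c l)) := by
  have hp0 : 0 < p := by linarith
  have hH : ∀ s, 0 < s → (∫⁻ y in cube c s, g y ^ p) ^ (1 / p) ≤
      ENNReal.ofReal (φ₁ c s * s ^ ((n : ℝ) / p)) * morreyNorm p φ₁ g := by
    intro s hs
    have h : (ENNReal.ofReal (φ₁ c s))⁻¹ *
        ((volume (cube c s))⁻¹ * ∫⁻ y in cube c s, g y ^ p) ^ (1 / p) ≤ morreyNorm p φ₁ g :=
      le_iSup₂_of_le c s (le_iSup_of_le hs le_rfl)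
    have hps : 0 < s ^ ((n : ℝ) / p) := by positivity
    rw [ENNReal.mul_rpow_of_nonneg _ _ (by positivity), ofReal_rpow_cube hs, Real.rpow_neg hs.le,
      ENNReal.ofReal_inv_of_pos hps, ← mul_assoc, ← ENNReal.mul_inv (by simp) (by simp),
      ← ENNReal.ofReal_mul (hφ₁ c s hs).le, ← ENNReal.div_eq_inv_mul,
      ENNReal.div_le_iff_le_mul (Or.inr hg) (by simp)] at h
    rwa [mul_comm]
  rw [tailIntegral]
  calc _ ≤ ∫⁻ τ in Ioi l, morreyNorm p φ₁ g *
        ((⨅ (s : ℝ) (_ : τ < s), ENNReal.ofReal (φ₁ c s * s ^ ((n : ℝ) / p))) *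
        ENNReal.ofReal (τ ^ (-((n : ℝ) / p) - 1))) := by
        refine setLIntegral_mono' measurableSet_Ioi fun t ht => ?_
        have ht : 0 < t := hl.trans ht
        rw [← mul_assoc]
        gcongr
        have hs : ∀ s, t < s → (∫⁻ y in cube c t, g y ^ p) ^ (1 / p) ≤
            ENNReal.ofReal (φ₁ c s * s ^ ((n : ℝ) / p)) * morreyNorm p φ₁ g := fun s hs =>
          (ENNReal.rpow_le_rpow (monotone_lintegral_cube _ c hs.le) (by positivity)).trans
            (hH s (ht.trans hs))
        rcases eq_or_ne (morreyNorm p φ₁ g) 0 with h0 | h0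
        · have := hs (t + 1) (by linarith)
          rw [h0, mul_zero] at this
          exact this.trans zero_le
        · rw [mul_comm, ← ENNReal.div_le_iff_le_mul (Or.inl h0) (Or.inl hg)]
          refine le_iInf₂ fun s hts => ?_
          rw [ENNReal.div_le_iff_le_mul (Or.inl h0) (Or.inl hg)]
          exact hs s hts
    _ = morreyNorm p φ₁ g * ∫⁻ τ in Ioi l,
        (⨅ (s : ℝ) (_ : τ < s), ENNReal.ofReal (φ₁ c s * s ^ ((n : ℝ) / p))) *
        ENNReal.ofReal (τ ^ (-((n : ℝ) / p) - 1)) := lintegral_const_mul' _ _ hg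
    _ ≤ _ := by gcongr; exact hK c l hl

/-- For t > 2l the norm over `cube c t` dominates that over the doubled cube, and t^{-n/p-1}
integrates over (2l,∞) to (2l)^{-n/p} p/n. Convergence uses n ≥ 1. -/
theorem inner_le_tailIntegral (hn : 1 ≤ n) {p : ℝ} (hp : 1 ≤ p) (g : (Fin n → ℝ) → ℝ≥0∞)
    (c : Fin n → ℝ) {l : ℝ} (hl : 0 < l) :
    (volume (cube c l))⁻¹ ^ (1 / p) * (∫⁻ y in cube c (2 * l), g y ^ p) ^ (1 / p) ≤
      ENNReal.ofReal (2 ^ ((n : ℝ) / p) * (n / p)) * tailIntegral p g c l := by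
  have hp0 : 0 < p := by linarith
  have hn0 : 0 < (n : ℝ) := by exact_mod_cast hn
  have h2 : 0 < 2 * l := by positivity
  have hd : 0 < (n : ℝ) / p := by positivity
  set H := (∫⁻ y in cube c (2 * l), g y ^ p) ^ (1 / p) with hH
  calc _ = ENNReal.ofReal (2 ^ ((n : ℝ) / p) * (n / p)) *
        (H * ∫⁻ t in Ioi (2 * l), ENNReal.ofReal (t ^ (-((n : ℝ) / p) - 1))) := by
        rw [lintegral_Ioi_rpow hd h2, ofReal_rpow_cube hl, mul_left_comm,
          ← ENNReal.ofReal_mul (by positivity), mul_comm]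
        congr 2
        rw [Real.mul_rpow (by norm_num) hl.le, Real.rpow_neg zero_le_two]
        field_simp
    _ = ENNReal.ofReal (2 ^ ((n : ℝ) / p) * (n / p)) *
        ∫⁻ t in Ioi (2 * l), H * ENNReal.ofReal (t ^ (-((n : ℝ) / p) - 1)) := by
        rw [lintegral_const_mul _ (by fun_prop)]
    _ ≤ ENNReal.ofReal (2 ^ ((n : ℝ) / p) * (n / p)) * ∫⁻ t in Ioi (2 * l),
        (∫⁻ y in cube c t, g y ^ p) ^ (1 / p) * ENNReal.ofReal (t ^ (-((n : ℝ) / p) - 1)) := by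
        gcongr _ * ?_
        refine setLIntegral_mono' measurableSet_Ioi fun t ht => ?_
        gcongr
        exact ENNReal.rpow_le_rpow (monotone_lintegral_cube _ c (le_of_lt ht)) (by positivity)
    _ ≤ _ := by
        rw [tailIntegral]
        gcongr
        linarith

/-- A cube of side m that contains x and leaves the doubled cube has m > l/2, hence lies in `cube c
(4 * m)`. Its average is written as an integral of t^{-n-1} over t > 4m, and enlarging the inner
cube to `cube c t` only increases it. -/
theorem maximal_outer_le (hn : 1 ≤ n) (f : (Fin n → ℝ) → ℝ≥0∞) {c x : Fin n → ℝ} {l : ℝ}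
    (hx : x ∈ cube c l) :
    maximal ((cube c (2 * l))ᶜ.indicator f) x ≤ ENNReal.ofReal (4 ^ n * n) *
      ∫⁻ t in Ioi l, ENNReal.ofReal (t ^ (-(n : ℝ) - 1)) * ∫⁻ y in cube c t, f y := by
  have hn0 : 0 < (n : ℝ) := by exact_mod_cast hn
  have hxc : dist x c ≤ l / 2 := hx
  refine maximal_le_iff.2 fun b m hm hxb => ?_
  have hxb' : dist x b ≤ m / 2 := hxb
  rw [lintegral_indicator (measurableSet_cube _ _).compl,
    Measure.restrict_restrict (measurableSet_cube _ _).compl]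
  rcases ((cube c (2 * l))ᶜ ∩ cube b m).eq_empty_or_nonempty with he | ⟨z, hz, hzb⟩
  · rw [he]; simp
  have hz : ¬ dist z c ≤ 2 * l / 2 := hz
  have hzb : dist z b ≤ m / 2 := hzb
  have hlm : l / 2 < m := by
    have h1 := dist_triangle z x c
    have h2 := dist_triangle_right z x b
    linarith
  have h4 : 0 < 4 * m := by positivity
  have hsub : cube b m ⊆ cube c (4 * m) := by
    refine Metric.closedBall_subset_closedBall' ?_
    have h1 := dist_triangle_left b c x
    linarith
  calc ∫⁻ y in (cube c (2 * l))ᶜ ∩ cube b m, f y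
      ≤ ∫⁻ y in cube c (4 * m), f y := lintegral_mono_set (inter_subset_right.trans hsub)
    _ = volume (cube b m) * (ENNReal.ofReal (4 ^ n * n) *
        ((∫⁻ t in Ioi (4 * m), ENNReal.ofReal (t ^ (-(n : ℝ) - 1))) *
          ∫⁻ y in cube c (4 * m), f y)) := by
        rw [lintegral_Ioi_rpow hn0 h4, volume_cube b hm.le, ← mul_assoc, ← mul_assoc,
          ← ENNReal.ofReal_mul (by positivity), ← ENNReal.ofReal_mul (by positivity)]
        have : m ^ n * (4 ^ n * n) * ((4 * m) ^ (-(n : ℝ)) / n) = 1 := by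
          rw [Real.rpow_neg h4.le, Real.rpow_natCast, mul_pow]
          field_simp
        rw [this, ENNReal.ofReal_one, one_mul]
    _ ≤ volume (cube b m) * (ENNReal.ofReal (4 ^ n * n) *
        ∫⁻ t in Ioi (4 * m), ENNReal.ofReal (t ^ (-(n : ℝ) - 1)) * ∫⁻ y in cube c t, f y) := by
        rw [← lintegral_mul_const _ (by fun_prop)]
        gcongr _ * (_ * ?_)
        refine setLIntegral_mono' measurableSet_Ioi fun t ht => ?_
        gcongr
        exact cube_subset_cube c (le_of_lt ht)
    _ ≤ _ := by
        gcongr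
        linarith

theorem lintegral_le_rpow_mul_volume {p : ℝ} (hp : 1 ≤ p) {g : (Fin n → ℝ) → ℝ≥0∞}
    (hg : Measurable g) (c : Fin n → ℝ) {t : ℝ} (ht : 0 < t) :
    ENNReal.ofReal (t ^ (-(n : ℝ) - 1)) * ∫⁻ y in cube c t, g y ≤
      (∫⁻ y in cube c t, g y ^ p) ^ (1 / p) * ENNReal.ofReal (t ^ (-((n : ℝ) / p) - 1)) := by
  rcases hp.eq_or_lt with rfl | hp
  · simp [mul_comm]
  have hconj : p.HolderConjugate (p / (p - 1)) := Real.HolderConjugate.conjExponent hp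
  have h := ENNReal.lintegral_mul_le_Lp_mul_Lq (volume.restrict (cube c t)) hconj hg.aemeasurable
    (aemeasurable_const (b := (1 : ℝ≥0∞)))
  simp only [Pi.mul_apply, mul_one, ENNReal.one_rpow, lintegral_const, Measure.restrict_apply_univ,
    one_mul] at h
  refine (mul_le_mul_right h _).trans (le_of_eq ?_)
  rw [mul_left_comm, volume_cube c ht.le, ENNReal.ofReal_rpow_of_pos (by positivity),
    ← ENNReal.ofReal_mul (by positivity)]
  congr 2
  rw [← Real.rpow_natCast, ← Real.rpow_mul ht.le, ← Real.rpow_add ht]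
  congr 1
  have : p - 1 ≠ 0 := by linarith
  field_simp
  ring

/-- Minkowski is used twice, for the integral in t and for the one over the cube; Hölder then turns
L^1 norms over cubes into L^p norms. -/
theorem lqNorm_maximal_outer_le (hn : 1 ≤ n) {p : ℝ} (hp : 1 ≤ p) {q : ℝ≥0∞} (hq : 1 < q)
    {f : ℤ → (Fin n → ℝ) → ℝ≥0∞} (hf : ∀ j, Measurable (f j)) {c x : Fin n → ℝ} {l : ℝ}
    (hl : 0 < l) (hx : x ∈ cube c l) :
    lqNorm q (fun j => maximal ((cube c (2 * l))ᶜ.indicator (f j)) x) ≤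
      ENNReal.ofReal (4 ^ n * n) * tailIntegral p (fun y => lqNorm q fun j => f j y) c l := by
  refine (lqNorm_mono fun j => maximal_outer_le hn (f j) hx).trans ?_
  rw [lqNorm_const_mul hq, tailIntegral]
  refine mul_le_mul_right ((lqNorm_lintegral_le hq fun j => ?_).trans ?_) _
  · exact Measurable.mul (by fun_prop) (monotone_lintegral_cube (f j) c).measurable
  · refine setLIntegral_mono' measurableSet_Ioi fun t ht => ?_
    rw [lqNorm_const_mul hq]
    refine (mul_le_mul_right (lqNorm_lintegral_le hq hf) _).trans ?_
    exact lintegral_le_rpow_mul_volume hp (measurable_lqNorm hf) c (hl.trans ht)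

theorem lintegral_lqNorm_indicator_rpow {q : ℝ≥0∞} (hq : 1 < q) {p : ℝ} (hp : 0 < p)
    (f : ℤ → (Fin n → ℝ) → ℝ≥0∞) {s : Set (Fin n → ℝ)} (hs : MeasurableSet s) :
    ∫⁻ x, lqNorm q (fun j => s.indicator (f j) x) ^ p =
      ∫⁻ x in s, lqNorm q (fun j => f j x) ^ p := by
  rw [← lintegral_indicator hs]
  refine lintegral_congr fun x => ?_
  rw [lqNorm_indicator hq]
  by_cases hx : x ∈ s
  · rw [indicator_of_mem hx, indicator_of_mem hx]
  · rw [indicator_of_notMem hx, indicator_of_notMem hx, ENNReal.zero_rpow_of_pos hp]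

theorem local_strong_estimate (hn : 1 ≤ n) {p : ℝ} (hp : 1 < p) {q : ℝ≥0∞} (hq : 1 < q) :
    ∃ C : ℝ≥0, ∀ f : ℤ → (Fin n → ℝ) → ℝ≥0∞, (∀ j, Measurable (f j)) →
      ∀ (c : Fin n → ℝ) (l : ℝ), 0 < l →
      ((volume (cube c l))⁻¹ * ∫⁻ x in cube c l, lqNorm q (fun j => maximal (f j) x) ^ p) ^ (1 / p)
        ≤ C * tailIntegral p (fun y => lqNorm q fun j => f j y) c l := by
  have hp0 : 0 < p := by linarith
  have hp1 : 0 ≤ 1 / p := by positivity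
  obtain ⟨C, hC⟩ := fefferman_stein_strong n hp hq
  refine ⟨C ^ (1 / p) * (2 ^ ((n : ℝ) / p) * (n / p)).toNNReal + (4 ^ n * n : ℝ).toNNReal,
    fun f hf c l hl => ?_⟩
  set J := tailIntegral p (fun y => lqNorm q fun j => f j y) c l with hJ
  set D := ENNReal.ofReal (4 ^ n * n) * J with hD
  set S₁ : (Fin n → ℝ) → ℝ≥0∞ :=
    fun x => lqNorm q fun j => maximal ((cube c (2 * l)).indicator (f j)) x with hS₁
  have hS₁m : Measurable S₁ := measurable_lqNorm_maximal _ _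
  have hV0 := volume_cube_ne_zero c hl
  have hVt := volume_cube_ne_top c hl
  rw [ENNReal.mul_rpow_of_nonneg _ _ hp1]
  -- On the cube the outer part is bounded by the constant `D`, whose normalized L^p norm is `D`
  -- itself.
  calc _ ≤ (volume (cube c l))⁻¹ ^ (1 / p) *
        (∫⁻ x in cube c l, (S₁ x + D) ^ p) ^ (1 / p) := by
        gcongr _ * ?_
        refine ENNReal.rpow_le_rpow (setLIntegral_mono' (measurableSet_cube c l) fun x hx => ?_) hp1
        refine ENNReal.rpow_le_rpow ?_ hp0.le
        exact (lqNorm_maximal_split hq hf (measurableSet_cube c (2 * l)) x).trans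
          (add_le_add le_rfl (lqNorm_maximal_outer_le hn hp.le hq hf hl hx))
    _ ≤ (volume (cube c l))⁻¹ ^ (1 / p) * ((∫⁻ x in cube c l, S₁ x ^ p) ^ (1 / p) +
        (∫⁻ x in cube c l, D ^ p) ^ (1 / p)) := by
        gcongr
        exact ENNReal.lintegral_Lp_add_le (g := fun _ => D) hS₁m.aemeasurable aemeasurable_const hp.le
    _ ≤ (volume (cube c l))⁻¹ ^ (1 / p) * ((C * ∫⁻ x in cube c (2 * l),
        lqNorm q (fun j => f j x) ^ p) ^ (1 / p) + (∫⁻ x in cube c l, D ^ p) ^ (1 / p)) := by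
        gcongr
        refine (setLIntegral_le_lintegral _ _).trans ?_
        rw [← lintegral_lqNorm_indicator_rpow hq hp0 f (measurableSet_cube c _)]
        exact hC _ fun j => (hf j).indicator (measurableSet_cube c _)
    _ = C ^ (1 / p) * ((volume (cube c l))⁻¹ ^ (1 / p) * (∫⁻ x in cube c (2 * l),
        lqNorm q (fun j => f j x) ^ p) ^ (1 / p)) + D := by
        rw [mul_add, ENNReal.mul_rpow_of_nonneg _ _ hp1, mul_left_comm]
        congr 1
        rw [setLIntegral_const, ← ENNReal.mul_rpow_of_nonneg _ _ hp1, mul_left_comm,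
          ENNReal.inv_mul_cancel hV0 hVt, mul_one, ← ENNReal.rpow_mul,
          mul_one_div_cancel hp0.ne', ENNReal.rpow_one]
    _ ≤ C ^ (1 / p) * (ENNReal.ofReal (2 ^ ((n : ℝ) / p) * (n / p)) * J) + D := by
        gcongr _ * ?_ + D
        exact inner_le_tailIntegral hn hp.le _ c hl
    _ = _ := by
        rw [hD, ENNReal.coe_add, ENNReal.coe_mul, ENNReal.coe_rpow_of_nonneg _ hp1]
        simp only [ENNReal.ofReal]
        ring

theorem local_weak_estimate (hn : 1 ≤ n) {p : ℝ} (hp : 1 ≤ p) {q : ℝ≥0∞} (hq : 1 < q) :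
    ∃ C : ℝ≥0, ∀ f : ℤ → (Fin n → ℝ) → ℝ≥0∞, (∀ j, Measurable (f j)) →
      ∀ (c : Fin n → ℝ) (l : ℝ), 0 < l → ∀ T : ℝ≥0,
      T * ((volume (cube c l))⁻¹ *
        volume ({x | T < lqNorm q fun j => maximal (f j) x} ∩ cube c l)) ^ (1 / p)
        ≤ C * tailIntegral p (fun y => lqNorm q fun j => f j y) c l := by
  have hp0 : 0 < p := by linarith
  have hp1 : 0 ≤ 1 / p := by positivity
  obtain ⟨C, hC⟩ := fefferman_stein_weak n hp hq
  refine ⟨2 * (C ^ (1 / p) * (2 ^ ((n : ℝ) / p) * (n / p)).toNNReal) +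
    2 * (4 ^ n * n : ℝ).toNNReal, fun f hf c l hl T => ?_⟩
  set J := tailIntegral p (fun y => lqNorm q fun j => f j y) c l with hJ
  set D := ENNReal.ofReal (4 ^ n * n) * J with hD
  have hV0 := volume_cube_ne_zero c hl
  have hVt := volume_cube_ne_top c hl
  have hconst : ((2 * (C ^ (1 / p) * (2 ^ ((n : ℝ) / p) * (n / p)).toNNReal) +
      2 * (4 ^ n * n : ℝ).toNNReal : ℝ≥0) : ℝ≥0∞) * J =
      2 * (C ^ (1 / p) * (ENNReal.ofReal (2 ^ ((n : ℝ) / p) * (n / p)) * J)) + 2 * D := by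
    rw [hD, ENNReal.coe_add, ENNReal.coe_mul, ENNReal.coe_mul, ENNReal.coe_mul,
      ENNReal.coe_rpow_of_nonneg _ hp1]
    simp only [ENNReal.ofReal, ENNReal.coe_ofNat]
    ring
  rw [hconst]
  -- For small `T` it suffices that the density of the level set is at most one. For larger `T` the
  -- outer part is at most T/2, so the inner part must exceed T/2.
  rcases le_or_gt (T : ℝ≥0∞) (2 * D) with hTD | hTD
  · refine le_trans ?_ (hTD.trans le_add_self)
    refine mul_le_of_le_one_right' (ENNReal.rpow_le_one ?_ hp1)
    calc _ ≤ (volume (cube c l))⁻¹ * volume (cube c l) := by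
          gcongr; exact inter_subset_right
      _ = 1 := ENNReal.inv_mul_cancel hV0 hVt
  · refine le_trans ?_ le_self_add
    have e2 : 2 * ((T / 2 : ℝ≥0) : ℝ≥0∞) = T := by
      rw [← ENNReal.coe_ofNat, ← ENNReal.coe_mul, mul_div_cancel₀ _ two_ne_zero]
    have hTD' : D ≤ (T / 2 : ℝ≥0) := by
      rw [← e2] at hTD
      exact ((ENNReal.mul_lt_mul_iff_right (by simp) (by simp)).1 hTD).le
    have hsub : {x | T < lqNorm q fun j => maximal (f j) x} ∩ cube c l ⊆
        {x | ((T / 2 : ℝ≥0) : ℝ≥0∞) <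
          lqNorm q fun j => maximal ((cube c (2 * l)).indicator (f j)) x} := by
      rintro x ⟨hxT, hx⟩
      have hxT : (T : ℝ≥0∞) < lqNorm q fun j => maximal (f j) x := hxT
      by_contra hcon
      have hcon : lqNorm q (fun j => maximal ((cube c (2 * l)).indicator (f j)) x) ≤
          (T / 2 : ℝ≥0) := not_lt.1 hcon
      refine hxT.not_ge ?_
      rw [← e2, two_mul]
      exact (lqNorm_maximal_split hq hf (measurableSet_cube c (2 * l)) x).trans
        (add_le_add hcon ((lqNorm_maximal_outer_le hn hp hq hf hl hx).trans hTD'))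
    have hweak := hC _ (fun j => (hf j).indicator (measurableSet_cube c (2 * l))) (T / 2)
    rw [lintegral_lqNorm_indicator_rpow hq hp0 f (measurableSet_cube c _)] at hweak
    calc _ = 2 * ((volume (cube c l))⁻¹ ^ (1 / p) * (((T / 2 : ℝ≥0) : ℝ≥0∞) ^ p *
          volume ({x | T < lqNorm q fun j => maximal (f j) x} ∩ cube c l)) ^ (1 / p)) := by
          rw [ENNReal.mul_rpow_of_nonneg _ _ hp1, ENNReal.mul_rpow_of_nonneg _ _ hp1,
            ← ENNReal.rpow_mul, mul_one_div_cancel hp0.ne', ENNReal.rpow_one]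
          nth_rw 1 [← e2]
          ring
      _ ≤ 2 * ((volume (cube c l))⁻¹ ^ (1 / p) * (C * ∫⁻ x in cube c (2 * l),
          lqNorm q (fun j => f j x) ^ p) ^ (1 / p)) := by
          gcongr 2 * (_ * ?_)
          exact ENNReal.rpow_le_rpow ((mul_le_mul_right (measure_mono hsub) _).trans hweak) hp1
      _ = 2 * (C ^ (1 / p) * ((volume (cube c l))⁻¹ ^ (1 / p) * (∫⁻ x in cube c (2 * l),
          lqNorm q (fun j => f j x) ^ p) ^ (1 / p))) := by
          rw [ENNReal.mul_rpow_of_nonneg _ _ hp1]; ring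
      _ ≤ _ := by
          gcongr 2 * (_ * ?_)
          exact inner_le_tailIntegral hn hp _ c hl

/-! ### From local estimates to Morrey norms. -/

theorem inv_ofReal_mul_le {a C K N X J : ℝ≥0∞} (ha0 : a ≠ 0) (ha : a ≠ ∞) (hX : X ≤ C * J)
    (hJ : J ≤ N * (K * a)) : a⁻¹ * X ≤ C * K * N := by
  rw [← ENNReal.div_eq_inv_mul, ENNReal.div_le_iff ha0 ha]
  calc X ≤ C * (N * (K * a)) := hX.trans (mul_le_mul_right hJ C)
    _ = _ := by ring

theorem morreyNorm_congr_ae (p : ℝ) (φ : (Fin n → ℝ) → ℝ → ℝ) {g h : (Fin n → ℝ) → ℝ≥0∞}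
    (hgh : g =ᵐ[volume] h) : morreyNorm p φ g = morreyNorm p φ h := by
  have key : ∀ s : Set (Fin n → ℝ), ∫⁻ y in s, g y ^ p = ∫⁻ y in s, h y ^ p := fun s =>
    lintegral_congr_ae (ae_restrict_of_ae (hgh.mono fun x hx => by simp only [hx]))
  simp only [morreyNorm, key]

/-- A sequence of a.e. measurable functions may be replaced by measurable moduli without changing
the maximal functions and the Morrey norm. -/
theorem exists_measurable_modulus {F : ℤ → (Fin n → ℝ) → ℂ} (hF : ∀ j, AEMeasurable (F j) volume)
    (p : ℝ) (φ : (Fin n → ℝ) → ℝ → ℝ) (q : ℝ≥0∞) :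
    ∃ f : ℤ → (Fin n → ℝ) → ℝ≥0∞, (∀ j, Measurable (f j)) ∧
      (∀ j, maximalFunction (F j) = maximal (f j)) ∧
      morreyLqNorm p φ q F = morreyNorm p φ fun x => lqNorm q fun j => f j x := by
  refine ⟨fun j x => ‖(hF j).mk (F j) x‖ₑ, fun j => (hF j).measurable_mk.enorm, fun j => ?_, ?_⟩
  · rw [maximalFunction_eq_maximal]
    exact maximal_congr_ae ((hF j).ae_eq_mk.mono fun x hx => by simp only [hx])
  · refine morreyNorm_congr_ae p φ ?_
    filter_upwards [ae_all_iff.2 fun j => (hF j).ae_eq_mk] with x hx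
    rw [lqNorm_enorm]
    simp only [hx]

end GenMorrey

end

theorem theorem3p4 (n : ℕ) (hn : 1 ≤ n) (p : ℝ) (hp : 1 ≤ p) (q : ℝ≥0∞) (hq : 1 < q)
    (φ₁ φ₂ : (Fin n → ℝ) → ℝ → ℝ)
    (hφ₁ : ∀ x t, 0 < t → 0 < φ₁ x t) (hφ₂ : ∀ x t, 0 < t → 0 < φ₂ x t)
    (hcond : GenMorrey.IntegralCondition p φ₁ φ₂) :
    (1 < p → ∃ C : ℝ≥0, ∀ F : ℤ → (Fin n → ℝ) → ℂ, GenMorrey.MemMorreyLq p φ₁ q F →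
      GenMorrey.MemMorreyLq p φ₂ q (fun j => GenMorrey.maximalFunction (F j)) ∧
      GenMorrey.morreyLqNorm p φ₂ q (fun j => GenMorrey.maximalFunction (F j)) ≤
        C * GenMorrey.morreyLqNorm p φ₁ q F) ∧
    (∃ C : ℝ≥0, ∀ F : ℤ → (Fin n → ℝ) → ℂ, GenMorrey.MemMorreyLq p φ₁ q F →
      GenMorrey.MemWeakMorreyLq p φ₂ q (fun j => GenMorrey.maximalFunction (F j)) ∧
      GenMorrey.weakMorreyLqNorm p φ₂ q (fun j => GenMorrey.maximalFunction (F j)) ≤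
        C * GenMorrey.morreyLqNorm p φ₁ q F) := by
  obtain ⟨K, hK⟩ := hcond
  have hp0 : 0 < p := by linarith
  have hfin : ∀ {C : ℝ≥0} {N X : ℝ≥0∞}, N < ∞ → X ≤ C * N → X < ∞ := fun hN hX =>
    hX.trans_lt (ENNReal.mul_lt_top ENNReal.coe_lt_top hN)
  refine ⟨fun hp1 => ?_, ?_⟩
  · obtain ⟨C, hC⟩ := GenMorrey.local_strong_estimate hn hp1 hq
    refine ⟨C * K, fun F hF => ?_⟩
    obtain ⟨f, hf, hmax, hnorm⟩ := GenMorrey.exists_measurable_modulus hF.1 p φ₁ q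
    have hle : GenMorrey.morreyLqNorm p φ₂ q (fun j => GenMorrey.maximalFunction (F j)) ≤
        (C * K : ℝ≥0) * GenMorrey.morreyLqNorm p φ₁ q F := by
      simp only [hmax]
      refine iSup₂_le fun c l => iSup_le fun hl => ?_
      rw [ENNReal.coe_mul, hnorm]
      -- The factor φ₂(c,l), positive and finite, cancels between the local estimate and the tail
      -- bound, so `C * K` serves for all cubes.
      refine GenMorrey.inv_ofReal_mul_le (by simp [hφ₂ c l hl]) ENNReal.ofReal_ne_top
        (hC f hf c l hl) (GenMorrey.tailIntegral_le_morreyNorm hp hφ₁ hK ?_ c hl)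
      rw [← hnorm]; exact hF.2.ne
    refine ⟨⟨fun j => ?_, hfin hF.2 hle⟩, hle⟩
    simp only [hmax]
    exact (GenMorrey.measurable_maximal _).aemeasurable
  · obtain ⟨C, hC⟩ := GenMorrey.local_weak_estimate hn hp hq
    refine ⟨C * K, fun F hF => ?_⟩
    obtain ⟨f, hf, hmax, hnorm⟩ := GenMorrey.exists_measurable_modulus hF.1 p φ₁ q
    have hle : GenMorrey.weakMorreyLqNorm p φ₂ q (fun j => GenMorrey.maximalFunction (F j)) ≤
        (C * K : ℝ≥0) * GenMorrey.morreyLqNorm p φ₁ q F := by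
      simp only [hmax]
      refine iSup₂_le fun T hT => ?_
      rw [GenMorrey.morreyNorm]
      simp only [ENNReal.mul_iSup]
      refine iSup₂_le fun c l => iSup_le fun hl => ?_
      have hind : ∫⁻ y in GenMorrey.cube c l,
          ({x | (T : ℝ≥0∞) < GenMorrey.lqNorm q fun j => GenMorrey.maximal (f j) x}.indicator 1 y :
            ℝ≥0∞) ^ p = volume ({x | (T : ℝ≥0∞) < GenMorrey.lqNorm q
              fun j => GenMorrey.maximal (f j) x} ∩ GenMorrey.cube c l) := by
        have hm : MeasurableSet {x | (T : ℝ≥0∞) < GenMorrey.lqNorm q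
            fun j => GenMorrey.maximal (f j) x} :=
          measurableSet_lt measurable_const (GenMorrey.measurable_lqNorm_maximal _ _)
        rw [← Measure.restrict_apply hm, ← lintegral_indicator_one hm]
        refine lintegral_congr fun x => ?_
        by_cases hx : x ∈ {x | (T : ℝ≥0∞) < GenMorrey.lqNorm q fun j => GenMorrey.maximal (f j) x}
        · rw [indicator_of_mem hx, Pi.one_apply, ENNReal.one_rpow]
        · rw [indicator_of_notMem hx, ENNReal.zero_rpow_of_pos hp0]
      rw [hind, ENNReal.coe_mul, hnorm, mul_left_comm]
      refine GenMorrey.inv_ofReal_mul_le (by simp [hφ₂ c l hl]) ENNReal.ofReal_ne_top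
        (hC f hf c l hl T) (GenMorrey.tailIntegral_le_morreyNorm hp hφ₁ hK ?_ c hl)
      rw [← hnorm]; exact hF.2.ne
    refine ⟨⟨fun j => ?_, hfin hF.2 hle⟩, hle⟩
    simp only [hmax]
    exact (GenMorrey.measurable_maximal _).aemeasurable
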